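/- Let $X$ be a proper ${\rm CAT}(0)$-space, let ${\rm Iso}(X)$ be its isometry group with the compact open topology, and let $G<{\rm Iso}(X)$ be a closed subgroup with limit set $\Lambda\subset\partial X$ (the set of accumulation points in the visual boundary $\partial X$ of the $G$-orbits on $X$). Assume that * $G$ is non-elementary, i.e. $\Lambda$ contains at least three points and $G$ fixes no point of $\partial X$; * $G$ contains a rank-one element, i.e. an axial isometry having, for some $B>0$, a $B$-contracting axis $\gamma$ (every closed metric ball disjoint from $\gamma$ has shortest-distance projection to $\gamma$ of diameter at most $B$); * $G$ acts transitively on the set of ordered pairs of distinct points of $\Lambda$. Let ${\cal P}_{\geq 3}(\Lambda)$ be the space of Borel probability measures on $\Lambda$ which are not concentrated on at most two points, with the weak$^*$-topology, and let $T\subset\Lambda^3$ be the space of triples of pairwise distinct points. Then: 1. The action of $G$ on ${\cal P}_{\geq 3}(\Lambda)$ is tame: its orbits are locally closed and the quotient Borel structure on ${\cal P}_{\geq 3}(\Lambda)/G$ is countably separated. 2. The stabilizer in $G$ of every $\mu\in{\cal P}_{\geq 3}(\Lambda)$ is compact. 3. The action of $G$ on $T$ is proper, i.e. $(g,t)\mapsto(gt,t)$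 is a proper map $G\times T\to T\times T$. 4. There are a number $R>0$ and a continuous $G$-equivariant map $\Phi:T\to X$ such that for every $(a,b,c)\in T$ the set $K(a,b,c)$ of all points of $X$ whose distance to each side of each ideal geodesic triangle with vertices $a,b,c$ is at most $R$ is non-empty and compact, and $\Phi(a,b,c)$ is a center of $K(a,b,c)$: a point $x$ for which the radius of the smallest closed ball about $x$ containing $K(a,b,c)$ is minimal. -/

import Mathlib

open Set Filter Topology MeasureTheory
open scoped NNReal

namespace RankOneCAT0

/-! ### CAT(0) spaces -/

/-- Any two points of `X` are joined by a geodesic segment. -/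
def IsGeodesicSpace (X : Type*) [MetricSpace X] : Prop :=
  ∀ x y : X, ∃ γ : ℝ → X, γ 0 = x ∧ γ (dist x y) = y ∧
    ∀ s ∈ Icc 0 (dist x y), ∀ t ∈ Icc 0 (dist x y), dist (γ s) (γ t) = |s - t|

/-- A geodesic metric space in which geodesic triangles are not thicker than their Euclidean
comparison triangles. In a geodesic space, `x` lies on some geodesic segment from `p` to `q` iff
`dist p x + dist x q = dist p q`; so `x` and `y` below are arbitrary points on two sides of an
arbitrary geodesic triangle with vertices `p, q, r`, and `x', y'` are their comparison points in
a comparison triangle `p', q', r'`. -/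
structure IsCAT0 (X : Type*) [MetricSpace X] : Prop where
  geodesic : IsGeodesicSpace X
  comparison : ∀ p q r x y : X,
    dist p x + dist x q = dist p q → dist p y + dist y r = dist p r →
    ∀ p' q' r' x' y' : EuclideanSpace ℝ (Fin 2),
      dist p' q' = dist p q → dist q' r' = dist q r → dist p' r' = dist p r →
      dist p' x' = dist p x → dist x' q' = dist x q →
      dist p' y' = dist p y → dist y' r' = dist y r →
      dist x y ≤ dist x' y'

/-! ### Rays, lines, the visual boundary and the cone topology -/

/-- Geodesic rays `[0, ∞) → X`. -/
structure GeodesicRay (X : Type*) [MetricSpace X] where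
  toFun : ℝ≥0 → X
  isometry : Isometry toFun

/-- Geodesic lines `ℝ → X`. -/
structure GeodesicLine (X : Type*) [MetricSpace X] where
  toFun : ℝ → X
  isometry : Isometry toFun

section Boundary

variable {X : Type*} [MetricSpace X]

instance : CoeFun (GeodesicRay X) (fun _ => ℝ≥0 → X) := ⟨GeodesicRay.toFun⟩

instance : CoeFun (GeodesicLine X) (fun _ => ℝ → X) := ⟨GeodesicLine.toFun⟩

/-- Two rays are asymptotic if they stay at bounded distance from each other. -/
instance asymptoticSetoid (X : Type*) [MetricSpace X] : Setoid (GeodesicRay X) where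
  r c c' := ∃ C : ℝ, ∀ t : ℝ≥0, dist (c t) (c' t) ≤ C
  iseqv :=
    { refl := fun c => ⟨0, fun t => (dist_self (c t)).le⟩
      symm := fun ⟨C, h⟩ => ⟨C, fun t => by rw [dist_comm]; exact h t⟩
      trans := fun ⟨C, h⟩ ⟨D, k⟩ =>
        ⟨C + D, fun t => (dist_triangle _ _ _).trans (add_le_add (h t) (k t))⟩ }

/-- The visual boundary `∂X`: asymptote classes of geodesic rays. -/
def Boundary (X : Type*) [MetricSpace X] : Type _ := Quotient (asymptoticSetoid X)

/-- The endpoint `c(∞)` of a ray. -/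
def GeodesicRay.endpoint (c : GeodesicRay X) : Boundary X := Quotient.mk _ c

/-- The endpoint `γ(∞)` of a line. -/
def GeodesicLine.posEnd (γ : GeodesicLine X) : Boundary X :=
  GeodesicRay.endpoint ⟨fun t => γ (t : ℝ), γ.isometry.comp (Isometry.of_dist_eq fun _ _ => rfl)⟩

/-- The endpoint `γ(-∞)` of a line. -/
def GeodesicLine.negEnd (γ : GeodesicLine X) : Boundary X :=
  GeodesicRay.endpoint ⟨fun t => γ (-(t : ℝ)),
    γ.isometry.comp ((IsometryEquiv.neg ℝ).isometry.comp (Isometry.of_dist_eq fun _ _ => rfl))⟩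

/-- The set `X ∪ ∂X`. -/
inductive Bordification (X : Type*) [MetricSpace X] : Type _
  | point (x : X) : Bordification X
  | ideal (ξ : Boundary X) : Bordification X

/-- The basic neighbourhood `U(c, r, ε)` of the endpoint of the ray `c`: all `z ∈ X ∪ ∂X` at
distance more than `r` from `c 0` such that the point at distance `r` from `c 0` on the geodesic
from `c 0` to `z` has distance less than `ε` from `c r`. -/
def coneNhd (c : GeodesicRay X) (r : ℝ≥0) (ε : ℝ) : Set (Bordification X) :=
  {z | (∃ x : X, z = .point x ∧ (r : ℝ) < dist (c 0) x ∧
          ∃ p : X, dist (c 0) p = r ∧ dist p x = dist (c 0) x - r ∧ dist p (c r) < ε) ∨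
       (∃ c' : GeodesicRay X, z = .ideal c'.endpoint ∧ c' 0 = c 0 ∧ dist (c' r) (c r) < ε)}

/-- The cone topology on `X ∪ ∂X`, generated by the open sets of `X` and the sets `U(c, r, ε)`. -/
instance (X : Type*) [MetricSpace X] : TopologicalSpace (Bordification X) :=
  TopologicalSpace.generateFrom
    ({U | ∃ V : Set X, IsOpen V ∧ U = Bordification.point '' V} ∪
     {U | ∃ (c : GeodesicRay X) (r : ℝ≥0) (ε : ℝ), 0 < r ∧ 0 < ε ∧ U = coneNhd c r ε})

/-- The visual boundary carries the subspace topology of the cone topology. -/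
instance (X : Type*) [MetricSpace X] : TopologicalSpace (Boundary X) :=
  TopologicalSpace.induced Bordification.ideal inferInstance

instance (X : Type*) [MetricSpace X] : MeasurableSpace (Boundary X) := borel _

instance (X : Type*) [MetricSpace X] : BorelSpace (Boundary X) := ⟨rfl⟩

/-! ### The isometry group and its actions -/

/-- The compact open topology on the isometry group. -/
instance (X : Type*) [MetricSpace X] : TopologicalSpace (X ≃ᵢ X) :=
  TopologicalSpace.induced (fun g => (⟨g, g.continuous⟩ : C(X, X))) ContinuousMap.compactOpen

/-- The image of a ray under an isometry. -/
def GeodesicRay.map (g : X ≃ᵢ X) (c : GeodesicRay X) : GeodesicRay X :=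
  ⟨fun t => g (c t), g.isometry.comp c.isometry⟩

/-- `Iso(X)` acts on `∂X` by `g • c(∞) = (g ∘ c)(∞)`. -/
instance (X : Type*) [MetricSpace X] : MulAction (X ≃ᵢ X) (Boundary X) where
  smul g := Quotient.map (GeodesicRay.map g) fun _ _ ⟨C, h⟩ =>
    ⟨C, fun t => (g.dist_eq _ _).trans_le (h t)⟩
  one_smul ξ := by
    induction ξ using Quotient.inductionOn
    rfl
  mul_smul g h ξ := by
    induction ξ using Quotient.inductionOn
    rfl

theorem smul_endpoint (g : X ≃ᵢ X) (c : GeodesicRay X) :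
    g • c.endpoint = (c.map g).endpoint := rfl

/-- The action of an isometry on `X ∪ ∂X`. -/
def Bordification.map (g : X ≃ᵢ X) : Bordification X → Bordification X
  | .point x => .point (g x)
  | .ideal ξ => .ideal (g • ξ)

theorem Bordification.map_inv_map (g : X ≃ᵢ X) (z : Bordification X) :
    (z.map g).map g⁻¹ = z := by
  cases z with
  | point x => exact congrArg Bordification.point (g.symm_apply_apply x)
  | ideal ξ => exact congrArg Bordification.ideal (inv_smul_smul g ξ)

theorem Bordification.map_map_inv (g : X ≃ᵢ X) (z : Bordification X) :
    (z.map g⁻¹).map g = z := by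
  simpa using Bordification.map_inv_map g⁻¹ z

theorem Bordification.map_mem_coneNhd (g : X ≃ᵢ X) (c : GeodesicRay X) (r : ℝ≥0) (ε : ℝ)
    {z : Bordification X} (hz : z ∈ coneNhd c r ε) : z.map g ∈ coneNhd (c.map g) r ε := by
  rcases hz with ⟨x, rfl, h1, p, h2, h3, h4⟩ | ⟨c', rfl, h1, h2⟩
  · refine Or.inl ⟨g x, rfl, ?_, g p, ?_, ?_, ?_⟩
    · exact h1.trans_eq (g.dist_eq _ _).symm
    · exact (g.dist_eq _ _).trans h2
    · exact (g.dist_eq _ _).trans (h3.trans (congrArg (· - (r : ℝ)) (g.dist_eq _ _).symm))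
    · exact (g.dist_eq _ _).trans_lt h4
  · exact Or.inr ⟨c'.map g, rfl, congrArg g h1, (g.dist_eq _ _).trans_lt h2⟩

theorem GeodesicRay.map_inv_map (g : X ≃ᵢ X) (c : GeodesicRay X) : (c.map g).map g⁻¹ = c := by
  cases c with
  | mk f hf =>
    have h : (fun t => g⁻¹ (g (f t))) = f := funext fun t => g.symm_apply_apply (f t)
    simp only [GeodesicRay.map, h]

theorem Bordification.continuous_map (g : X ≃ᵢ X) : Continuous (Bordification.map g) := by
  refine continuous_generateFrom_iff.2 ?_
  rintro U (⟨V, hV, rfl⟩ | ⟨c, r, ε, hr, hε, rfl⟩)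
  · have : Bordification.map g ⁻¹' (Bordification.point '' V)
        = Bordification.point '' (g ⁻¹' V) := by
      ext z
      cases z <;> simp [Bordification.map]
    rw [this]
    exact TopologicalSpace.isOpen_generateFrom_of_mem
      (Or.inl ⟨_, hV.preimage g.continuous, rfl⟩)
  · have : Bordification.map g ⁻¹' coneNhd c r ε = coneNhd (c.map g⁻¹) r ε := by
      ext z
      constructor
      · intro hz
        simpa [Bordification.map_inv_map] using Bordification.map_mem_coneNhd g⁻¹ c r ε hz
      · intro hz
        have h := Bordification.map_mem_coneNhd g _ r ε hz
        have h' := GeodesicRay.map_inv_map g⁻¹ c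
        rw [inv_inv] at h'
        rwa [h'] at h
    rw [this]
    exact TopologicalSpace.isOpen_generateFrom_of_mem (Or.inr ⟨_, r, ε, hr, hε, rfl⟩)

theorem Boundary.continuous_smul (g : X ≃ᵢ X) : Continuous fun ξ : Boundary X => g • ξ :=
  continuous_induced_rng.2
    ((Bordification.continuous_map g).comp (continuous_induced_dom (f := Bordification.ideal)) :
      Continuous (Bordification.ideal ∘ fun ξ : Boundary X => g • ξ))

/-! ### Limit sets and non-elementary groups -/

/-- The limit set of `G` as a `G`-invariant subset of `∂X`: the accumulation points in `∂X` of
the orbits of `G` on `X`. -/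
def limitSet (G : Subgroup (X ≃ᵢ X)) : SubMulAction G (Boundary X) where
  carrier := {ξ | ∃ x : X, AccPt (Bordification.ideal ξ)
    (𝓟 {z | ∃ g ∈ G, z = Bordification.point (g x)})}
  smul_mem' := by
    rintro ⟨g, hg⟩ ξ ⟨x, hx⟩
    refine ⟨x, ?_⟩
    have hinj : Function.Injective (Bordification.map g) :=
      Function.LeftInverse.injective (g := Bordification.map g⁻¹) (Bordification.map_inv_map g)
    have h := AccPt.map hx (Bordification.continuous_map g).continuousAt hinj
    rw [map_principal] at h
    refine h.mono (principal_mono.2 ?_)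
    rintro _ ⟨_, ⟨k, hk, rfl⟩, rfl⟩
    exact ⟨g * k, G.mul_mem hg hk, rfl⟩

/-- `G` is non-elementary: its limit set has at least three points, and `G` has no global fixed
point in `∂X`. -/
def IsNonElementary (G : Subgroup (X ≃ᵢ X)) : Prop :=
  3 ≤ (limitSet G : Set (Boundary X)).encard ∧ ¬ ∃ ξ : Boundary X, ∀ g : G, g • ξ = ξ

/-! ### Rank-one isometries -/

/-- The image of `K` under the shortest distance projection to `S`. -/
def projectionImage (S K : Set X) : Set X :=
  {p | p ∈ S ∧ ∃ x ∈ K, ∀ q ∈ S, dist x p ≤ dist x q}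

/-- `γ` is `B`-contracting: every closed metric ball disjoint from `γ` projects to a subset of
`γ` of diameter at most `B`. -/
def IsContracting (B : ℝ) (γ : GeodesicLine X) : Prop :=
  ∀ (x : X) (r : ℝ), Disjoint (Metric.closedBall x r) (range γ) →
    ∀ p ∈ projectionImage (range γ) (Metric.closedBall x r),
    ∀ q ∈ projectionImage (range γ) (Metric.closedBall x r), dist p q ≤ B

/-- The displacement function of `g` assumes its minimum `τ`, and `τ` is positive. -/
def IsAxialWith (g : X ≃ᵢ X) (τ : ℝ) : Prop :=
  0 < τ ∧ (∃ x, dist x (g x) = τ) ∧ ∀ x, τ ≤ dist x (g x)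

/-- `g` is axial and admits a `B`-contracting (oriented) axis for some `B > 0`. -/
def IsRankOne (g : X ≃ᵢ X) : Prop :=
  ∃ B > 0, ∃ τ : ℝ, IsAxialWith g τ ∧
    ∃ γ : GeodesicLine X, (∀ t, g (γ t) = γ (t + τ)) ∧ IsContracting B γ

/-! ### Triples of limit points and their centers -/

/-- Ordered triples of pairwise distinct points of the limit set. -/
def limitTriples (G : Subgroup (X ≃ᵢ X)) :
    SubMulAction G (limitSet G × limitSet G × limitSet G) where
  carrier := {t | t.1 ≠ t.2.1 ∧ t.2.1 ≠ t.2.2 ∧ t.2.2 ≠ t.1}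
  smul_mem' g _ h :=
    ⟨fun e => h.1 (MulAction.injective g e), fun e => h.2.1 (MulAction.injective g e),
      fun e => h.2.2 (MulAction.injective g e)⟩

/-- The vertices of a triple. -/
def vertices {G : Subgroup (X ≃ᵢ X)} (t : limitTriples G) : Set (Boundary X) :=
  {(t.1.1 : Boundary X), (t.1.2.1 : Boundary X), (t.1.2.2 : Boundary X)}

/-- The points of `X` whose distance to every side of every ideal geodesic triangle with the
vertices `t` is at most `R`. (The two endpoints of a geodesic line are always distinct.) -/
def quasiCenters {G : Subgroup (X ≃ᵢ X)} (R : ℝ) (t : limitTriples G) : Set X :=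
  {x | ∀ γ : GeodesicLine X, γ.negEnd ∈ vertices t → γ.posEnd ∈ vertices t →
    Metric.infDist x (range γ) ≤ R}

/-- `x` is a center of `K`: the radius of the smallest closed ball about `x` containing `K` is
minimal among all points of `X`. -/
def IsCenter (K : Set X) (x : X) : Prop :=
  ∀ (y : X) (r : ℝ), K ⊆ Metric.closedBall y r → K ⊆ Metric.closedBall x r

/-! ### Probability measures on the limit set -/

theorem limitSet_continuous_smul {G : Subgroup (X ≃ᵢ X)} (g : G) :
    Continuous fun ξ : limitSet G => g • ξ :=
  ((Boundary.continuous_smul (g : X ≃ᵢ X)).comp continuous_subtype_val).subtype_mk _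

/-- `G` acts on the Borel probability measures on its limit set by push-forward. -/
noncomputable instance (G : Subgroup (X ≃ᵢ X)) :
    MulAction G (ProbabilityMeasure (limitSet G)) where
  smul g μ := μ.map (f := fun ξ => g • ξ) (limitSet_continuous_smul g).measurable.aemeasurable
  one_smul μ := by
    apply Subtype.ext
    change Measure.map (fun ξ : limitSet G => (1 : G) • ξ) (μ : Measure (limitSet G)) = μ
    simp
  mul_smul g h μ := by
    apply Subtype.ext
    change Measure.map (fun ξ : limitSet G => (g * h) • ξ) (μ : Measure (limitSet G)) =
      Measure.map (fun ξ : limitSet G => g • ξ)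
        (Measure.map (fun ξ : limitSet G => h • ξ) (μ : Measure (limitSet G)))
    rw [Measure.map_map (limitSet_continuous_smul g).measurable
      (limitSet_continuous_smul h).measurable]
    simp only [Function.comp_def, mul_smul]

theorem toMeasure_smul {G : Subgroup (X ≃ᵢ X)} (g : G) (μ : ProbabilityMeasure (limitSet G)) :
    ((g • μ : ProbabilityMeasure (limitSet G)) : Measure (limitSet G)) =
      (μ : Measure (limitSet G)).map fun ξ => g • ξ := rfl

/-- The probability measures on the limit set that are not concentrated on at most two points;
as a subspace of `ProbabilityMeasure (limitSet G)` it carries the weak* topology. -/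
def measuresGeThree (G : Subgroup (X ≃ᵢ X)) :
    SubMulAction G (ProbabilityMeasure (limitSet G)) where
  carrier := {μ | ∀ a b : limitSet G, (μ : Measure (limitSet G)) {a, b}ᶜ ≠ 0}
  smul_mem' g μ hμ a b h := by
    let e : limitSet G ≃ₜ limitSet G :=
      { toEquiv := MulAction.toPerm g
        continuous_toFun := limitSet_continuous_smul g
        continuous_invFun := limitSet_continuous_smul g⁻¹ }
    have h1 : (μ : Measure (limitSet G)).map e.toMeasurableEquiv {a, b}ᶜ = 0 := h
    rw [MeasurableEquiv.map_apply] at h1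
    refine hμ (g⁻¹ • a) (g⁻¹ • b) (measure_mono_null ?_ h1)
    intro ξ hξ hab
    apply hξ
    have hab' : g • ξ = a ∨ g • ξ = b := hab
    rcases hab' with rfl | rfl <;> simp

end Boundary

/-! ### Tame actions -/

/-- An action on a topological space is tame if its orbits are locally closed and the quotient
Borel structure on the space of orbits is countably separated. -/
structure IsTameAction (G S : Type*) [Group G] [TopologicalSpace S] [MulAction G S] : Prop where
  isLocallyClosed_orbit : ∀ s : S, IsLocallyClosed (MulAction.orbit G s)
  countablySeparated : @MeasurableSpace.CountablySeparated (MulAction.orbitRel.Quotient G S)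
    ((borel S).map (Quotient.mk (MulAction.orbitRel G S)))

end RankOneCAT0

/-!
In an ideal triangle two of whose sides are asymptotic to a contracting side, the projection of the
two other sides to the contracting one is coarsely the projection of their common endpoint, so the
three sides pass close to a common point. Transitivity on pairs of limit points makes all geodesics
between limit points contracting with the same constant. The distance to the sides of a triangle is
then a proper convex function on `X` depending continuously on the vertices, and the unique center
of a sublevel set of this function is a continuous equivariant map from triples to `X`. As the
action on `X` is proper, so is the action on triples.

A measure not concentrated on two points charges, through its third power, a compact set of
triples. By properness, all but a compact set of group elements move almost all of the mass of a
fixed measure on triples away from a given compact set. Hence the orbit maps of measures are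
proper, so stabilizers are compact and orbits are closed.
-/

namespace RankOneCAT0

/-! ### Comparison triangles -/

theorem exists_triangle_of_le_add {E : Type*} [NormedAddCommGroup E] [NormedSpace ℝ E]
    (hE : 1 < Module.rank ℝ E) {a b c : ℝ} (ha : a ≤ b + c) (hb : b ≤ a + c) (hc : c ≤ a + b) :
    ∃ p q r : E, dist p q = a ∧ dist q r = b ∧ dist p r = c := by
  have : Nontrivial E := rank_pos_iff_nontrivial.1 (zero_lt_one.trans hE)
  obtain ⟨u, hu⟩ := exists_norm_eq E zero_le_one
  have ha0 : 0 ≤ a := by linarith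
  have hc0 : 0 ≤ c := by linarith
  have hdist (x y : ℝ) : dist (x • u) (y • u) = |x - y| := by
    rw [dist_eq_norm, ← sub_smul, norm_smul, hu, mul_one, Real.norm_eq_abs]
  have hmem (x : ℝ) (hx : |x| = c) : x • u ∈ Metric.sphere (0 : E) c := by
    rw [mem_sphere_zero_iff_norm, norm_smul, hu, mul_one, Real.norm_eq_abs, hx]
  obtain ⟨r, hr, hb'⟩ : b ∈ (fun r => dist (a • u) r) '' Metric.sphere (0 : E) c := by
    refine (isPreconnected_sphere hE 0 c).intermediate_value (hmem c (abs_of_nonneg hc0))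
      (hmem (-c) (by rw [abs_neg, abs_of_nonneg hc0]))
      (continuous_const.dist continuous_id').continuousOn ⟨?_, ?_⟩
    · rw [hdist]
      exact abs_sub_le_iff.2 ⟨by linarith, by linarith⟩
    · rw [hdist, sub_neg_eq_add, abs_of_nonneg (add_nonneg ha0 hc0)]
      exact hb
  refine ⟨0, a • u, r, ?_, hb', by rwa [dist_comm]⟩
  simpa [abs_of_nonneg ha0] using hdist 0 a

section Between

variable {X : Type*} [MetricSpace X] {x y z p q r x' y' z' : X} {s t : ℝ}

theorem exists_comparison_triangle (p q r : X) : ∃ p' q' r' : EuclideanSpace ℝ (Fin 2),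
    dist p' q' = dist p q ∧ dist q' r' = dist q r ∧ dist p' r' = dist p r :=
  exists_triangle_of_le_add (by simp [← Module.finrank_eq_rank])
    (by rw [dist_comm q r, add_comm]; exact dist_triangle _ _ _)
    (by rw [dist_comm p q]; exact dist_triangle _ _ _) (dist_triangle _ _ _)

/-- `z` lies on a geodesic segment from `x` to `y` and divides it in the ratio `t : 1 - t`. The
segment itself is not part of the data: only the distances to its endpoints are recorded. -/
structure Between (x y : X) (t : ℝ) (z : X) : Prop where
  mem_Icc : t ∈ Icc (0 : ℝ) 1
  dist_left : dist x z = t * dist x y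
  dist_right : dist z y = (1 - t) * dist x y

theorem Between.dist_add_dist (h : Between x y t z) : dist x z + dist z y = dist x y := by
  rw [h.dist_left, h.dist_right]
  ring

theorem Between.symm (h : Between x y t z) : Between y x (1 - t) z where
  mem_Icc := ⟨sub_nonneg.2 h.mem_Icc.2, sub_le_self _ h.mem_Icc.1⟩
  dist_left := by rw [dist_comm y z, dist_comm y x, h.dist_right]
  dist_right := by rw [dist_comm z x, dist_comm y x, h.dist_left, sub_sub_cancel]

theorem between_right (x y : X) : Between x y 1 y := ⟨by simp, by simp, by simp⟩

theorem between_of_dist_add_dist (h : dist x z + dist z y = dist x y) :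
    Between x y (dist x z / dist x y) z := by
  have hle : dist x z ≤ dist x y := by linarith [dist_nonneg (x := z) (y := y)]
  have hmul : dist x z / dist x y * dist x y = dist x z :=
    div_mul_cancel_of_imp fun h0 => le_antisymm (hle.trans h0.le) dist_nonneg
  exact ⟨⟨by positivity, div_le_one_of_le₀ hle dist_nonneg⟩, hmul.symm,
    by rw [sub_mul, one_mul, hmul, ← h, add_sub_cancel_left]⟩

theorem IsGeodesicSpace.exists_between_apply_eq (hX : IsGeodesicSpace X) {f : X → ℝ}
    (hf : Continuous f) {v : ℝ} (hv : v ∈ Icc (f x) (f y)) :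
    ∃ t z, Between x y t z ∧ f z = v := by
  obtain ⟨γ, rfl, hγy, hγ⟩ := hX x y
  set ℓ := dist (γ 0) y
  have hℓ : 0 ≤ ℓ := dist_nonneg
  have hcont : ContinuousOn γ (Icc 0 ℓ) :=
    (LipschitzOnWith.of_dist_le_mul (K := 1) fun s hs t ht => by
      rw [hγ s hs t ht, NNReal.coe_one, one_mul, Real.dist_eq]).continuousOn
  rw [← hγy] at hv
  obtain ⟨s, hs, hsv⟩ := intermediate_value_Icc hℓ (hf.comp_continuousOn hcont) hv
  refine ⟨_, γ s, between_of_dist_add_dist ?_, hsv⟩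
  have hleft : dist (γ 0) (γ s) = s := by
    rw [hγ 0 ⟨le_rfl, hℓ⟩ s hs, zero_sub, abs_neg, abs_of_nonneg hs.1]
  have hright : dist (γ s) y = ℓ - s := by
    rw [← hγy, hγ s hs ℓ ⟨hℓ, le_rfl⟩, abs_sub_comm, abs_of_nonneg (sub_nonneg.2 hs.2)]
  rw [hleft, hright, add_sub_cancel]

theorem IsGeodesicSpace.exists_between (hX : IsGeodesicSpace X) (x y : X) (ht : t ∈ Icc (0 : ℝ) 1) :
    ∃ z, Between x y t z := by
  obtain ⟨_, z, hz, hxz⟩ := hX.exists_between_apply_eq (f := fun z => dist x z)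
    (continuous_const.dist continuous_id') (v := t * dist x y)
    ⟨by rw [dist_self]; exact mul_nonneg ht.1 dist_nonneg, mul_le_of_le_one_left dist_nonneg ht.2⟩
  exact ⟨z, ht, hxz, by linarith [hz.dist_add_dist]⟩

theorem IsCAT0.dist_le_dist_lineMap (hX : IsCAT0 X) (hx : Between p q s x) (hy : Between p r t y)
    {p' q' r' : EuclideanSpace ℝ (Fin 2)} (hpq : dist p' q' = dist p q)
    (hqr : dist q' r' = dist q r) (hpr : dist p' r' = dist p r) :
    dist x y ≤ dist (AffineMap.lineMap p' q' s) (AffineMap.lineMap p' r' t) :=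
  hX.comparison p q r x y hx.dist_add_dist hy.dist_add_dist p' q' r' _ _ hpq hqr hpr
    (by rw [dist_left_lineMap, hpq, hx.dist_left, Real.norm_of_nonneg hx.mem_Icc.1])
    (by rw [dist_lineMap_right, hpq, hx.dist_right,
      Real.norm_of_nonneg (sub_nonneg.2 hx.mem_Icc.2)])
    (by rw [dist_left_lineMap, hpr, hy.dist_left, Real.norm_of_nonneg hy.mem_Icc.1])
    (by rw [dist_lineMap_right, hpr, hy.dist_right,
      Real.norm_of_nonneg (sub_nonneg.2 hy.mem_Icc.2)])

theorem IsCAT0.dist_le_mul_of_between (hX : IsCAT0 X) (hx : Between p q t x)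
    (hy : Between p r t y) : dist x y ≤ t * dist q r := by
  obtain ⟨p', q', r', hpq, hqr, hpr⟩ := exists_comparison_triangle p q r
  calc dist x y ≤ dist (AffineMap.lineMap p' q' t) (AffineMap.lineMap p' r' t) :=
        hX.dist_le_dist_lineMap hx hy hpq hqr hpr
    _ = ‖t • (q' - r')‖ := by
        rw [dist_eq_norm, AffineMap.lineMap_apply_module, AffineMap.lineMap_apply_module]
        congr 1
        module
    _ = t * dist q r := by
        rw [norm_smul, Real.norm_of_nonneg hx.mem_Icc.1, ← dist_eq_norm, hqr]

theorem IsCAT0.dist_le_of_between (hX : IsCAT0 X) (hz : Between x y t z)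
    (hz' : Between x' y' t z') : dist z z' ≤ (1 - t) * dist x x' + t * dist y y' := by
  obtain ⟨w, hw⟩ := hX.geodesic.exists_between x y' hz.mem_Icc
  have hzw := hX.dist_le_mul_of_between hz hw
  have hwz' := hX.dist_le_mul_of_between hw.symm hz'.symm
  linarith [dist_triangle z w z']

/-- The CN inequality of Bruhat and Tits. -/
theorem IsCAT0.dist_sq_midpoint_le (hX : IsCAT0 X) (hz : Between q r (1 / 2) z) (p : X) :
    dist p z ^ 2 ≤ (dist p q ^ 2 + dist p r ^ 2) / 2 - dist q r ^ 2 / 4 := by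
  obtain ⟨q', r', p', hqr, hrp, hqp⟩ := exists_comparison_triangle q r p
  have hle := hX.dist_le_dist_lineMap hz (between_right q p) hqr hrp hqp
  rw [AffineMap.lineMap_apply_one, one_div, ← invOf_eq_inv, ← midpoint] at hle
  have hap := EuclideanGeometry.dist_sq_add_dist_sq_eq_two_mul_dist_midpoint_sq_add_half_dist_sq
    p' q' r'
  rw [dist_comm p' q', dist_comm p' r', dist_comm p' (midpoint ℝ q' r'), hqp, hrp, hqr] at hap
  rw [dist_comm p z, dist_comm p q, dist_comm p r]
  have hsq := pow_le_pow_left₀ dist_nonneg hle 2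
  linarith

end Between

/-! ### Geodesically convex functions -/

section GeodesicallyConvex

variable {X : Type*} [MetricSpace X]

/-- A function on a metric space that is convex along geodesic segments. -/
def GeodesicallyConvex (f : X → ℝ) : Prop :=
  ∀ ⦃x y z : X⦄ ⦃t : ℝ⦄, Between x y t z → f z ≤ (1 - t) * f x + t * f y

theorem GeodesicallyConvex.le_max {f : X → ℝ} (hf : GeodesicallyConvex f) {x y z : X} {t : ℝ}
    (hz : Between x y t z) : f z ≤ max (f x) (f y) :=
  calc f z ≤ (1 - t) * f x + t * f y := hf hz
    _ ≤ (1 - t) * max (f x) (f y) + t * max (f x) (f y) := by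
        have := sub_nonneg.2 hz.mem_Icc.2
        have := hz.mem_Icc.1
        gcongr
        exacts [le_max_left _ _, le_max_right _ _]
    _ = max (f x) (f y) := by ring

theorem GeodesicLine.dist_eq (γ : GeodesicLine X) (s t : ℝ) : dist (γ s) (γ t) = |s - t| := by
  rw [γ.isometry.dist_eq, Real.dist_eq]

theorem GeodesicLine.between (γ : GeodesicLine X) (a b : ℝ) {t : ℝ} (ht : t ∈ Icc (0 : ℝ) 1) :
    Between (γ a) (γ b) t (γ (AffineMap.lineMap a b t)) where
  mem_Icc := ht
  dist_left := by
    rw [γ.isometry.dist_eq, dist_left_lineMap, γ.isometry.dist_eq, Real.norm_of_nonneg ht.1]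
  dist_right := by
    rw [γ.isometry.dist_eq, dist_lineMap_right, γ.isometry.dist_eq,
      Real.norm_of_nonneg (sub_nonneg.2 ht.2)]

theorem GeodesicLine.exists_infDist_eq_dist (γ : GeodesicLine X) (x : X) :
    ∃ s, Metric.infDist x (range γ) = dist x (γ s) := by
  have hlim : Tendsto (fun s => dist x (γ s)) (cocompact ℝ) atTop := by
    refine tendsto_atTop_mono (fun s => ?_)
      (tendsto_atTop_add_const_right _ (-dist x (γ 0)) (tendsto_norm_cocompact_atTop (E := ℝ)))
    have := dist_triangle (γ s) x (γ 0)
    rw [γ.dist_eq, sub_zero, dist_comm (γ s), ← Real.norm_eq_abs] at this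
    linarith
  obtain ⟨s, hs⟩ := (continuous_const.dist γ.isometry.continuous).exists_forall_le hlim
  refine ⟨s, le_antisymm (Metric.infDist_le_dist_of_mem ⟨s, rfl⟩) ?_⟩
  rw [Metric.le_infDist (range_nonempty _)]
  rintro _ ⟨t, rfl⟩
  exact hs t

theorem GeodesicLine.infDist_le_dist (γ : GeodesicLine X) (x : X) (s : ℝ) :
    Metric.infDist x (range γ) ≤ dist x (γ s) := Metric.infDist_le_dist_of_mem ⟨s, rfl⟩

theorem IsCAT0.geodesicallyConvex_infDist (hX : IsCAT0 X) (γ : GeodesicLine X) :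
    GeodesicallyConvex fun x => Metric.infDist x (range γ) := by
  intro x y z t hz
  obtain ⟨a, ha⟩ := γ.exists_infDist_eq_dist x
  obtain ⟨b, hb⟩ := γ.exists_infDist_eq_dist y
  simp only [ha, hb]
  exact (γ.infDist_le_dist z _).trans (hX.dist_le_of_between hz (γ.between a b hz.mem_Icc))

theorem GeodesicallyConvex.convexOn_comp_line {f : X → ℝ} (hf : GeodesicallyConvex f)
    (γ : GeodesicLine X) : ConvexOn ℝ univ fun t => f (γ t) := by
  refine ⟨convex_univ, fun a _ b _ u v _ hv huv => ?_⟩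
  obtain rfl : u = 1 - v := eq_sub_of_add_eq huv
  have := hf (γ.between a b (t := v) ⟨hv, by linarith⟩)
  rwa [AffineMap.lineMap_apply_module] at this

theorem eq_of_convexOn_univ_of_forall_le {E : Type*} [AddCommGroup E] [Module ℝ E] {f : E → ℝ}
    (hf : ConvexOn ℝ univ f) {C : ℝ} (hC : ∀ x, f x ≤ C) (x y : E) : f x = f y := by
  suffices hle : ∀ x y, f y ≤ f x from le_antisymm (hle y x) (hle x y)
  intro x y
  have hlim : Tendsto (fun ε : ℝ => (1 - ε) * f x + ε * C) (𝓝[>] 0) (𝓝 (f x)) := by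
    refine (Continuous.tendsto' ?_ 0 _ (by simp)).mono_left nhdsWithin_le_nhds
    fun_prop
  refine ge_of_tendsto hlim ?_
  filter_upwards [Ioo_mem_nhdsGT (zero_lt_one (α := ℝ))] with ε hε
  have hy : (1 - ε) • x + ε • (x + ε⁻¹ • (y - x)) = y := by
    rw [smul_add, smul_inv_smul₀ hε.1.ne']
    module
  calc f y ≤ (1 - ε) * f x + ε * f (x + ε⁻¹ • (y - x)) := by
        conv_lhs => rw [← hy]
        exact hf.2 (mem_univ _) (mem_univ _) (sub_nonneg.2 hε.2.le) hε.1.le (by ring)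
    _ ≤ (1 - ε) * f x + ε * C := by
        gcongr
        exacts [hε.1.le, hC _]

end GeodesicallyConvex

/-! ### Centers of bounded sets -/

section Center

variable {X : Type*} [MetricSpace X] {K : Set X} {x y : X}

/-- The radius of the smallest closed ball about `x` that contains `K`. It is only meaningful if
`K` is non-empty and bounded. -/
noncomputable def radiusAbout (K : Set X) (x : X) : ℝ := ⨆ y : K, dist (y : X) x

theorem radiusAbout_le_iff (hK : Bornology.IsBounded K) (hne : K.Nonempty) {r : ℝ} :
    radiusAbout K x ≤ r ↔ K ⊆ Metric.closedBall x r := by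
  have : Nonempty K := hne.to_subtype
  obtain ⟨D, hD⟩ := hK.subset_closedBall x
  have hbdd : BddAbove (range fun y : K => dist (y : X) x) :=
    ⟨D, by rintro _ ⟨y, rfl⟩; exact hD y.2⟩
  rw [radiusAbout, ciSup_le_iff hbdd, Subtype.forall]
  rfl

theorem subset_closedBall_radiusAbout (hK : Bornology.IsBounded K) (hne : K.Nonempty) (x : X) :
    K ⊆ Metric.closedBall x (radiusAbout K x) :=
  (radiusAbout_le_iff hK hne).1 le_rfl

theorem isCenter_iff_radiusAbout_le (hK : Bornology.IsBounded K) (hne : K.Nonempty) :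
    IsCenter K x ↔ ∀ y, radiusAbout K x ≤ radiusAbout K y := by
  simp only [IsCenter, ← radiusAbout_le_iff hK hne]
  exact ⟨fun h y => h y _ le_rfl, fun h y r hr => (h y).trans hr⟩

theorem lipschitzWith_radiusAbout (hK : Bornology.IsBounded K) (hne : K.Nonempty) :
    LipschitzWith 1 (radiusAbout K) := by
  refine LipschitzWith.of_le_add fun x y => (radiusAbout_le_iff hK hne).2 fun z hz => ?_
  have hzy : dist z y ≤ radiusAbout K y := subset_closedBall_radiusAbout hK hne y hz
  rw [Metric.mem_closedBall]
  linarith [dist_triangle_right z x y]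

theorem exists_isCenter [ProperSpace X] (hK : Bornology.IsBounded K) (hne : K.Nonempty) :
    ∃ x, IsCenter K x := by
  obtain ⟨k, hk⟩ := id hne
  have hlim : Tendsto (radiusAbout K) (cocompact X) atTop :=
    tendsto_atTop_mono (fun x => subset_closedBall_radiusAbout hK hne x hk)
      (by simpa only [dist_comm] using tendsto_dist_right_cocompact_atTop k)
  have : Nonempty X := ⟨k⟩
  simp only [isCenter_iff_radiusAbout_le hK hne]
  exact (lipschitzWith_radiusAbout hK hne).continuous.exists_forall_le hlim

theorem IsCAT0.isCenter_unique (hX : IsCAT0 X) (hK : Bornology.IsBounded K) (hne : K.Nonempty)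
    (hx : IsCenter K x) (hy : IsCenter K y) : x = y := by
  by_contra hxy
  set r := radiusAbout K x
  have hKx : K ⊆ Metric.closedBall x r := subset_closedBall_radiusAbout hK hne x
  have hKy : K ⊆ Metric.closedBall y r := hy x r hKx
  have hd : 0 < dist x y := dist_pos.2 hxy
  have hr : 0 < r := by
    obtain ⟨k, hk⟩ := hne
    linarith [dist_triangle_left x y k, Metric.mem_closedBall.1 (hKx hk),
      Metric.mem_closedBall.1 (hKy hk)]
  obtain ⟨m, hm⟩ := hX.geodesic.exists_between x y (t := 1 / 2) (by norm_num)
  have hKm : K ⊆ Metric.closedBall m √(r ^ 2 - dist x y ^ 2 / 4) := fun z hz => by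
    have hzx := pow_le_pow_left₀ dist_nonneg (Metric.mem_closedBall.1 (hKx hz)) 2
    have hzy := pow_le_pow_left₀ dist_nonneg (Metric.mem_closedBall.1 (hKy hz)) 2
    exact Real.le_sqrt_of_sq_le (by linarith [hX.dist_sq_midpoint_le hm z])
  have hle : r ≤ √(r ^ 2 - dist x y ^ 2 / 4) := (radiusAbout_le_iff hK hne).2 (hx m _ hKm)
  have hlt : √(r ^ 2 - dist x y ^ 2 / 4) < r := (Real.sqrt_lt' hr).2 (by linarith [pow_pos hd 2])
  exact hle.not_gt hlt

theorem IsCenter.image (g : X ≃ᵢ X) (hx : IsCenter K x) : IsCenter (g '' K) (g x) := by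
  intro y r hy
  rw [image_subset_iff, g.preimage_closedBall] at hy ⊢
  simpa only [g.symm_apply_apply] using hx _ r hy

end Center

/-! ### Centers of sublevel sets of convex functions -/

section SublevelCenter

variable {X T : Type*} [MetricSpace X] [TopologicalSpace T] {F : T → X → ℝ} {R : ℝ} {t : T}

theorem eventually_sublevel_subset_closedBall [ProperSpace X] (hX : IsGeodesicSpace X)
    (hF : Continuous (Function.uncurry F)) (hconv : ∀ t, GeodesicallyConvex (F t))
    (hlt : ∃ x, F t x < R) {y : X} {r ε : ℝ} (hε : 0 < ε)
    (hsub : {x | F t x ≤ R} ⊆ Metric.closedBall y r) :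
    ∀ᶠ t' in 𝓝 t, {x | F t' x ≤ R} ⊆ Metric.closedBall y (r + ε) := by
  obtain ⟨x₀, hx₀⟩ := hlt
  have hsphere : ∀ᶠ t' in 𝓝 t, ∀ x ∈ Metric.sphere y (r + ε), R < F t' x := by
    refine (isCompact_sphere y (r + ε)).eventually_forall_of_forall_eventually fun x hx => ?_
    refine (hF.tendsto (t, x)).eventually_const_lt (not_le.1 fun hle => ?_)
    have : dist x y ≤ r := hsub hle
    linarith [Metric.mem_sphere.1 hx]
  have hx₀' : ∀ᶠ t' in 𝓝 t, F t' x₀ < R :=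
    ((hF.comp (Continuous.prodMk_left x₀)).tendsto t).eventually_lt_const hx₀
  filter_upwards [hsphere, hx₀'] with t' hsphere hx₀' k hk
  -- A segment from `x₀` to a point outside the ball crosses the sphere.
  by_contra hkb
  have hx₀y : dist x₀ y ≤ r := hsub hx₀.le
  obtain ⟨_, z, hz, hzy⟩ := hX.exists_between_apply_eq
    (f := fun z => dist z y) (continuous_id'.dist continuous_const) (x := x₀) (y := k) (v := r + ε)
    ⟨by linarith, (not_le.1 hkb).le⟩
  exact ((hconv t').le_max hz).not_gt ((max_le hx₀'.le hk).trans_lt (hsphere z hzy))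

theorem eventually_exists_sublevel_dist_lt (hX : IsGeodesicSpace X)
    (hF : Continuous (Function.uncurry F)) (hconv : GeodesicallyConvex (F t))
    (hlt : ∃ x, F t x < R) {k : X} (hk : F t k ≤ R) {ε : ℝ} (hε : 0 < ε) :
    ∀ᶠ t' in 𝓝 t, ∃ k', F t' k' ≤ R ∧ dist k k' < ε := by
  obtain ⟨x₀, hx₀⟩ := hlt
  have hd : 0 < dist k x₀ + ε := by positivity
  obtain ⟨z, hz⟩ := hX.exists_between k x₀ (t := ε / (dist k x₀ + ε))
    ⟨by positivity, (div_le_one hd).2 (by linarith [dist_nonneg (x := k) (y := x₀)])⟩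
  have hFz : F t z < R := by
    have hpos : 0 < ε / (dist k x₀ + ε) := by positivity
    nlinarith [hconv hz, hz.mem_Icc.2]
  have hkz : dist k z < ε := by
    rw [hz.dist_left, div_mul_eq_mul_div, div_lt_iff₀ hd]
    nlinarith
  filter_upwards [((hF.comp (Continuous.prodMk_left z)).tendsto t).eventually_lt_const hFz]
    with t' ht'
  exact ⟨z, ht'.le, hkz⟩

theorem exists_tendsto_of_eventually_dist_le [ProperSpace X] {ι : Type*} (U : Ultrafilter ι)
    {f : ι → X} {x : X} {C : ℝ} (h : ∀ᶠ i in U, dist (f i) x ≤ C) :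
    ∃ y, Tendsto f U (𝓝 y) := by
  obtain ⟨y, -, hy⟩ := (isCompact_closedBall x C).ultrafilter_le_nhds (U.map f)
    (le_principal_iff.2 h)
  exact ⟨y, hy⟩

theorem isCenter_sublevel_of_tendsto [ProperSpace X] (hX : IsGeodesicSpace X)
    (hF : Continuous (Function.uncurry F)) (hconv : ∀ t, GeodesicallyConvex (F t))
    (hlt : ∃ x, F t x < R) {Φ : T → X} (hΦ : ∀ t, IsCenter {x | F t x ≤ R} (Φ t))
    {U : Filter T} [U.NeBot] (hU : U ≤ 𝓝 t) {z : X} (hz : Tendsto Φ U (𝓝 z)) :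
    IsCenter {x | F t x ≤ R} z := by
  intro y r hsub k hk
  refine le_of_forall_pos_le_add fun ε hε => le_of_tendsto (tendsto_const_nhds.dist hz) ?_
  filter_upwards [hU (eventually_sublevel_subset_closedBall hX hF hconv hlt (half_pos hε) hsub),
    hU (eventually_exists_sublevel_dist_lt hX hF (hconv t) hlt hk (half_pos hε))]
    with t' hball ⟨k', hk', hkk'⟩
  have : dist k' (Φ t') ≤ r + ε / 2 := hΦ t' _ _ hball hk'
  linarith [dist_triangle k k' (Φ t')]

theorem continuous_isCenter_sublevel [ProperSpace X] (hX : IsCAT0 X)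
    (hF : Continuous (Function.uncurry F)) (hconv : ∀ t, GeodesicallyConvex (F t))
    (hlt : ∀ t, ∃ x, F t x < R) (hbdd : ∀ t, Bornology.IsBounded {x | F t x ≤ R}) {Φ : T → X}
    (hΦ : ∀ t, IsCenter {x | F t x ≤ R} (Φ t)) : Continuous Φ := by
  refine continuous_iff_ultrafilter.2 fun t U hU => ?_
  obtain ⟨x₀, hx₀⟩ := hlt t
  obtain ⟨r, hr⟩ := (hbdd t).subset_closedBall x₀
  have hbound : ∀ᶠ t' in U, dist (Φ t') x₀ ≤ (r + 1) + (r + 1) := by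
    filter_upwards [hU (eventually_sublevel_subset_closedBall hX.geodesic hF hconv (hlt t)
      one_pos hr)] with t' ht'
    obtain ⟨k, hk⟩ := hlt t'
    have hkx₀ : dist k x₀ ≤ r + 1 := ht' hk.le
    have hkΦ : dist k (Φ t') ≤ r + 1 := hΦ t' _ _ ht' hk.le
    linarith [dist_triangle_left (Φ t') x₀ k]
  obtain ⟨z, hz⟩ := exists_tendsto_of_eventually_dist_le U hbound
  have hzt := isCenter_sublevel_of_tendsto hX.geodesic hF hconv (hlt t) hΦ hU hz
  rwa [hX.isCenter_unique (hbdd t) ⟨x₀, hx₀.le⟩ (hΦ t) hzt]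

end SublevelCenter

/-! ### Asymptotic rays -/

section Rays

variable {X : Type*} [MetricSpace X]

@[ext]
theorem GeodesicRay.ext {c c' : GeodesicRay X} (h : ∀ t, c t = c' t) : c = c' := by
  cases c
  cases c'
  congr
  exact funext h

theorem GeodesicRay.dist_eq (c : GeodesicRay X) (s t : ℝ≥0) : dist (c s) (c t) = |(s : ℝ) - t| := by
  rw [c.isometry.dist_eq, NNReal.dist_eq]

theorem GeodesicRay.dist_zero_apply (c : GeodesicRay X) (t : ℝ≥0) : dist (c 0) (c t) = t := by
  rw [c.dist_eq, NNReal.coe_zero, zero_sub, abs_neg, NNReal.abs_eq]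

theorem GeodesicRay.between (c : GeodesicRay X) (s : ℝ≥0) {t : ℝ≥0} (ht : t ≤ 1) :
    Between (c 0) (c s) t (c (t * s)) where
  mem_Icc := ⟨t.coe_nonneg, ht⟩
  dist_left := by rw [c.dist_zero_apply, c.dist_zero_apply, NNReal.coe_mul]
  dist_right := by
    have : (t : ℝ) * s ≤ s := mul_le_of_le_one_left s.coe_nonneg ht
    rw [c.dist_zero_apply, c.dist_eq, NNReal.coe_mul, abs_sub_comm,
      abs_of_nonneg (sub_nonneg.2 this), sub_mul, one_mul]

theorem GeodesicRay.between_of_le (c : GeodesicRay X) {t s : ℝ≥0} (hts : t ≤ s) (hs : 0 < s) :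
    Between (c 0) (c s) (t / s) (c t) := by
  simpa only [div_mul_cancel₀ t hs.ne', NNReal.coe_div] using
    c.between s (div_le_one_of_le₀ hts zero_le)

theorem GeodesicRay.endpoint_eq_iff {c c' : GeodesicRay X} : c.endpoint = c'.endpoint ↔ c ≈ c' :=
  Quotient.eq

theorem GeodesicRay.tendsto_dist_atTop (c : GeodesicRay X) (x : X) :
    Tendsto (fun t => dist x (c t)) atTop atTop := by
  refine tendsto_atTop_mono (fun t => ?_)
    (tendsto_atTop_add_const_right _ (-dist (c 0) x) (NNReal.tendsto_coe_atTop.2 tendsto_id))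
  rw [← sub_eq_add_neg, sub_le_iff_le_add', ← c.dist_zero_apply]
  exact dist_triangle _ _ _

theorem IsCAT0.dist_ray_le (hX : IsCAT0 X) {c c' : GeodesicRay X} (h : c ≈ c') (t : ℝ≥0) :
    dist (c t) (c' t) ≤ dist (c 0) (c' 0) := by
  obtain ⟨C, hC⟩ := h
  have hlim : Tendsto (fun s : ℝ≥0 => (1 - (t : ℝ) / s) * dist (c 0) (c' 0) + t / s * C) atTop
      (𝓝 ((1 - 0) * dist (c 0) (c' 0) + 0 * C)) := by
    have h0 : Tendsto (fun s : ℝ≥0 => (t : ℝ) / s) atTop (𝓝 0) :=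
      tendsto_const_nhds.div_atTop (NNReal.tendsto_coe_atTop.2 tendsto_id)
    exact ((tendsto_const_nhds.sub h0).mul_const _).add (h0.mul_const _)
  rw [sub_zero, one_mul, zero_mul, add_zero] at hlim
  refine ge_of_tendsto hlim ?_
  filter_upwards [eventually_ge_atTop t, eventually_gt_atTop 0] with s hs hs0
  refine (hX.dist_le_of_between (c.between_of_le hs hs0) (c'.between_of_le hs hs0)).trans ?_
  gcongr
  exact hC s

theorem IsCAT0.ray_unique (hX : IsCAT0 X) {c c' : GeodesicRay X} (h : c ≈ c') (h0 : c 0 = c' 0) :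
    c = c' :=
  GeodesicRay.ext fun t => dist_le_zero.1 <| (hX.dist_ray_le h t).trans_eq (by rw [h0, dist_self])

theorem IsCAT0.dist_apply_ray_le (hX : IsCAT0 X) (c : GeodesicRay X) {x z p : X} {t : ℝ} {r : ℝ≥0}
    (hp : Between x z t p) (hr : dist x p = r) (s : ℝ≥0) :
    dist p (c r) ≤ dist x (c 0) + 2 * t * dist z (c s) := by
  obtain ⟨t, rfl⟩ : ∃ t' : ℝ≥0, (t' : ℝ) = t := ⟨⟨t, hp.mem_Icc.1⟩, rfl⟩
  have hq : dist p (c (t * s)) ≤ (1 - t) * dist x (c 0) + t * dist z (c s) :=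
    hX.dist_le_of_between hp (c.between s hp.mem_Icc.2)
  have hqr : dist (c (t * s)) (c r) ≤ t * (dist x (c 0) + dist z (c s)) := by
    have hsub : |(s : ℝ) - dist x z| ≤ dist x (c 0) + dist z (c s) := by
      have := dist_dist_dist_le (c 0) (c s) x z
      rwa [Real.dist_eq, c.dist_zero_apply, dist_comm (c 0), dist_comm (c s)] at this
    rw [c.dist_eq, NNReal.coe_mul, ← hr, hp.dist_left, ← mul_sub, abs_mul, NNReal.abs_eq]
    gcongr
  linarith [dist_triangle p (c (t * s)) (c r)]

end Rays

section ProperRays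

variable {X : Type*} [MetricSpace X] [ProperSpace X]

theorem exists_ray_of_eventually_isometry {ι : Type*} (U : Ultrafilter ι) {σ : ι → ℝ≥0 → X} {x : X}
    (h0 : Tendsto (fun i => σ i 0) U (𝓝 x))
    (h : ∀ s t, ∀ᶠ i in U, dist (σ i s) (σ i t) = |(s : ℝ) - t|) :
    ∃ c : GeodesicRay X, c 0 = x ∧ ∀ t, Tendsto (fun i => σ i t) U (𝓝 (c t)) := by
  have hex (t : ℝ≥0) : ∃ y, Tendsto (fun i => σ i t) U (𝓝 y) := by
    refine exists_tendsto_of_eventually_dist_le U (x := x) (C := t + 1) ?_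
    filter_upwards [h t 0, h0.eventually (Metric.ball_mem_nhds x one_pos)] with i hi hi'
    rw [NNReal.coe_zero, sub_zero, NNReal.abs_eq] at hi
    linarith [dist_triangle (σ i t) (σ i 0) x, Metric.mem_ball.1 hi']
  choose f hf using hex
  refine ⟨⟨f, Isometry.of_dist_eq fun s t => ?_⟩, tendsto_nhds_unique (hf 0) h0, hf⟩
  rw [NNReal.dist_eq]
  exact tendsto_nhds_unique ((hf s).dist (hf t))
    (tendsto_const_nhds.congr' ((h s t).mono fun i hi => hi.symm))

theorem exists_ray_limit {ι : Type*} (U : Ultrafilter ι) {c : ι → GeodesicRay X} {x : X}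
    (h0 : Tendsto (fun i => c i 0) U (𝓝 x)) :
    ∃ c' : GeodesicRay X, c' 0 = x ∧ ∀ t, Tendsto (fun i => c i t) U (𝓝 (c' t)) :=
  exists_ray_of_eventually_isometry U h0 fun s t =>
    Eventually.of_forall fun i => (c i).dist_eq s t

theorem IsCAT0.exists_asymptotic_ray (hX : IsCAT0 X) (x : X) (c : GeodesicRay X) :
    ∃ c' : GeodesicRay X, c' 0 = x ∧ c' ≈ c := by
  -- An ultrafilter limit of the geodesics from `x` to `c n`.
  choose γ hγ0 hγ1 hγ using fun n : ℕ => hX.geodesic x (c n)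
  let U : Ultrafilter ℕ := hyperfilter ℕ
  have hlarge (t : ℝ≥0) : ∀ᶠ n in U, (t : ℝ) ≤ dist x (c (n : ℕ)) :=
    Nat.hyperfilter_le_atTop <| ((c.tendsto_dist_atTop x).comp
      tendsto_natCast_atTop_atTop).eventually_ge_atTop _
  obtain ⟨c', hc0, hc'⟩ := exists_ray_of_eventually_isometry U (x := x) (σ := fun n t => γ n t)
    (by simpa only [NNReal.coe_zero, hγ0] using tendsto_const_nhds) (fun s t => by
      filter_upwards [hlarge s, hlarge t] with n hs ht
      exact hγ n s ⟨s.coe_nonneg, hs⟩ t ⟨t.coe_nonneg, ht⟩)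
  refine ⟨c', hc0, dist x (c 0), fun t => le_of_tendsto ((hc' t).dist tendsto_const_nhds) ?_⟩
  filter_upwards [hlarge t] with n hn
  have hmem : (t : ℝ) ∈ Icc 0 (dist x (c n)) := ⟨t.coe_nonneg, hn⟩
  have hleft : dist x (γ n t) = t := by
    conv_lhs => rw [← hγ0 n]
    rw [hγ n 0 ⟨le_rfl, dist_nonneg⟩ t hmem, zero_sub, abs_neg, NNReal.abs_eq]
  have hright : dist (γ n t) (c n) = dist x (c n) - t := by
    conv_lhs => rw [← hγ1 n]
    rw [hγ n t hmem _ ⟨dist_nonneg, le_rfl⟩, abs_sub_comm, abs_of_nonneg (sub_nonneg.2 hn)]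
  have hle := hX.dist_apply_ray_le c
    (between_of_dist_add_dist (y := c n) (by rw [hleft, hright, add_sub_cancel])) hleft n
  rwa [dist_self, mul_zero, add_zero] at hle

theorem IsCAT0.exists_ray (hX : IsCAT0 X) (x : X) (ξ : Boundary X) :
    ∃ c : GeodesicRay X, c 0 = x ∧ c.endpoint = ξ := by
  induction ξ using Quotient.inductionOn with
  | h c =>
    obtain ⟨c', h0, h⟩ := hX.exists_asymptotic_ray x c
    exact ⟨c', h0, Quotient.sound h⟩

/-- The unique geodesic ray that starts at `x` and ends at `ξ`. -/
noncomputable def IsCAT0.ray (hX : IsCAT0 X) (x : X) (ξ : Boundary X) : GeodesicRay X :=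
  (hX.exists_ray x ξ).choose

theorem IsCAT0.ray_zero (hX : IsCAT0 X) (x : X) (ξ : Boundary X) : hX.ray x ξ 0 = x :=
  (hX.exists_ray x ξ).choose_spec.1

theorem IsCAT0.endpoint_ray (hX : IsCAT0 X) (x : X) (ξ : Boundary X) :
    (hX.ray x ξ).endpoint = ξ := (hX.exists_ray x ξ).choose_spec.2

theorem IsCAT0.ray_endpoint (hX : IsCAT0 X) (c : GeodesicRay X) :
    hX.ray (c 0) c.endpoint = c :=
  hX.ray_unique (GeodesicRay.endpoint_eq_iff.1 (hX.endpoint_ray _ _)) (hX.ray_zero _ _)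

theorem IsCAT0.tendsto_asymptotic_ray (hX : IsCAT0 X) {ι : Type*} {F : Filter ι}
    {c c' : ι → GeodesicRay X} {d d' : GeodesicRay X}
    (hc : ∀ t, Tendsto (fun i => c i t) F (𝓝 (d t))) (hasymp : ∀ i, c i ≈ c' i) (hd : d ≈ d')
    (h0 : Tendsto (fun i => c' i 0) F (𝓝 (d' 0))) (t : ℝ≥0) :
    Tendsto (fun i => c' i t) F (𝓝 (d' t)) := by
  refine tendsto_iff_ultrafilter _ _ _ |>.2 fun U hU => ?_
  obtain ⟨e, he0, he⟩ := exists_ray_limit U (h0.mono_left hU)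
  have hde : d ≈ e := ⟨dist (d 0) (d' 0), fun s =>
    le_of_tendsto_of_tendsto (((hc s).mono_left hU).dist (he s))
      (((hc 0).mono_left hU).dist (h0.mono_left hU))
      (Eventually.of_forall fun i => hX.dist_ray_le (hasymp i) s)⟩
  rw [← hX.ray_unique (Setoid.trans (Setoid.symm hde) hd) he0]
  exact he t

end ProperRays

/-! ### The topology of the boundary -/

section BoundaryTopology

variable {X : Type*} [MetricSpace X] [ProperSpace X]

theorem IsCAT0.ideal_mem_coneNhd (hX : IsCAT0 X) (c : GeodesicRay X) (r : ℝ≥0) (ε : ℝ)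
    (ξ : Boundary X) :
    Bordification.ideal ξ ∈ coneNhd c r ε ↔ dist (hX.ray (c 0) ξ r) (c r) < ε := by
  constructor
  · rintro (⟨x, hx, -⟩ | ⟨c', h, h0, hr⟩)
    · cases hx
    · obtain rfl : ξ = c'.endpoint := by injection h
      rwa [← h0, hX.ray_endpoint c']
  · exact fun h => Or.inr ⟨hX.ray (c 0) ξ, by rw [hX.endpoint_ray], hX.ray_zero _ _, h⟩

theorem IsCAT0.continuous_ray (hX : IsCAT0 X) (x : X) (t : ℝ≥0) :
    Continuous fun ξ => hX.ray x ξ t := by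
  refine continuous_iff_continuousAt.2 fun ξ => Metric.tendsto_nhds.2 fun ε hε => ?_
  rcases eq_or_ne t 0 with rfl | ht
  · simp [hX.ray_zero, hε]
  · have hopen : IsOpen (coneNhd (hX.ray x ξ) t ε) :=
      TopologicalSpace.isOpen_generateFrom_of_mem
        (Or.inr ⟨_, t, ε, pos_iff_ne_zero.2 ht, hε, rfl⟩)
    have hmem : ξ ∈ Bordification.ideal ⁻¹' coneNhd (hX.ray x ξ) t ε := by
      rw [mem_preimage, hX.ideal_mem_coneNhd, hX.ray_zero, dist_self]
      exact hε
    filter_upwards [(hopen.preimage continuous_induced_dom).mem_nhds hmem] with η hη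
    rwa [mem_preimage, hX.ideal_mem_coneNhd, hX.ray_zero] at hη

theorem IsCAT0.continuous_of_continuous_ray (hX : IsCAT0 X) {S : Type*} [TopologicalSpace S]
    {f : S → Boundary X} (x : X) (hf : ∀ t, Continuous fun s => hX.ray x (f s) t) :
    Continuous f := by
  refine continuous_induced_rng.2 (continuous_generateFrom_iff.2 ?_)
  rintro U (⟨V, -, rfl⟩ | ⟨c, r, ε, -, -, rfl⟩)
  · have hempty : (fun s => Bordification.ideal (f s)) ⁻¹' (Bordification.point '' V) = ∅ := by
      ext s
      simp
    exact hempty ▸ isOpen_empty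
  · have hcont : Continuous fun s => hX.ray (c 0) (f s) r := by
      refine continuous_iff_continuousAt.2 fun s => ?_
      have hasymp (η : Boundary X) : hX.ray x η ≈ hX.ray (c 0) η := by
        rw [← GeodesicRay.endpoint_eq_iff, hX.endpoint_ray, hX.endpoint_ray]
      refine hX.tendsto_asymptotic_ray (fun t => (hf t).tendsto s) (fun _ => hasymp _) (hasymp _)
        ?_ r
      simpa only [hX.ray_zero] using tendsto_const_nhds
    convert (Metric.isOpen_ball (x := c r) (ε := ε)).preimage hcont using 1
    ext s
    exact hX.ideal_mem_coneNhd c r ε (f s)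

theorem IsCAT0.isInducing_ray (hX : IsCAT0 X) (x : X) :
    IsInducing fun (ξ : Boundary X) (t : ℝ≥0) => hX.ray x ξ t := by
  refine ⟨le_antisymm (continuous_iff_le_induced.1 <| continuous_pi (hX.continuous_ray x)) ?_⟩
  let τ : TopologicalSpace (Boundary X) :=
    TopologicalSpace.induced (fun ξ (t : ℝ≥0) => hX.ray x ξ t) inferInstance
  exact continuous_id_iff_le.1 <| hX.continuous_of_continuous_ray (S := Boundary X) x fun t =>
    (continuous_apply t).comp continuous_induced_dom

theorem IsCAT0.tendsto_boundary_iff (hX : IsCAT0 X) (x : X) {ι : Type*} {F : Filter ι}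
    {f : ι → Boundary X} {ξ : Boundary X} :
    Tendsto f F (𝓝 ξ) ↔ ∀ t, Tendsto (fun i => hX.ray x (f i) t) F (𝓝 (hX.ray x ξ t)) := by
  rw [(hX.isInducing_ray x).tendsto_nhds_iff, tendsto_pi_nhds]
  rfl

theorem IsCAT0.injective_ray_natCast (hX : IsCAT0 X) (x : X) :
    Function.Injective fun (ξ : Boundary X) (n : ℕ) => hX.ray x ξ n := by
  intro ξ η h
  rw [← hX.endpoint_ray x ξ, ← hX.endpoint_ray x η, GeodesicRay.endpoint_eq_iff]
  refine ⟨0, fun t => ?_⟩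
  obtain ⟨n, hn⟩ := exists_nat_gt t
  have hn0 : (0 : ℝ≥0) < n := zero_le.trans_lt hn
  have hle := hX.dist_le_of_between ((hX.ray x ξ).between_of_le hn.le hn0)
    ((hX.ray x η).between_of_le hn.le hn0)
  have heq : hX.ray x ξ n = hX.ray x η n := congrFun h n
  rwa [heq, hX.ray_zero, hX.ray_zero, dist_self, dist_self, mul_zero, mul_zero, add_zero] at hle

theorem IsCAT0.compactSpace_boundary (hX : IsCAT0 X) : CompactSpace (Boundary X) := by
  refine ⟨isCompact_iff_ultrafilter_le_nhds.2 fun U _ => ?_⟩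
  obtain ⟨⟨c₀⟩, -⟩ := U.nonempty_of_mem univ_mem
  obtain ⟨c, h0, hc⟩ := exists_ray_limit U (c := fun ξ => hX.ray (c₀ 0) ξ) (x := c₀ 0)
    (by simpa only [hX.ray_zero] using tendsto_const_nhds)
  refine ⟨c.endpoint, mem_univ _, ?_⟩
  have : Tendsto id (U : Filter (Boundary X)) (𝓝 c.endpoint) := by
    rw [hX.tendsto_boundary_iff (c₀ 0), ← h0, hX.ray_endpoint c, h0]
    exact hc
  exact this

theorem IsCAT0.metrizableSpace_boundary (hX : IsCAT0 X) :
    TopologicalSpace.MetrizableSpace (Boundary X) := by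
  rcases isEmpty_or_nonempty (Boundary X) with _ | ⟨⟨ξ⟩⟩
  · have : DiscreteTopology (Boundary X) := Subsingleton.discreteTopology
    infer_instance
  · obtain ⟨c, -⟩ : ∃ c : GeodesicRay X, c.endpoint = ξ := Quotient.exists_rep ξ
    have := hX.compactSpace_boundary
    exact ((continuous_pi fun n : ℕ => hX.continuous_ray (c 0) n).isClosedEmbedding
      (hX.injective_ray_natCast (c 0))).isEmbedding.metrizableSpace

end BoundaryTopology

/-! ### The isometry group -/

section Isometries

variable {X : Type*} [MetricSpace X]

/-- The tautological action of the isometry group. -/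
instance isometryEquivMulAction : MulAction (X ≃ᵢ X) X where
  smul g x := g x
  one_smul _ := rfl
  mul_smul _ _ _ := rfl

theorem continuous_isometryEquiv_apply (x : X) : Continuous fun g : X ≃ᵢ X => g x := by
  have h : Continuous fun g : X ≃ᵢ X => (⟨g, g.continuous⟩ : C(X, X)) := continuous_induced_dom
  exact (continuous_eval_const (F := C(X, X)) x).comp h

theorem tendsto_isometryEquiv_iff {ι : Type*} {F : Filter ι} {f : ι → X ≃ᵢ X} {g : X ≃ᵢ X} :
    Tendsto f F (𝓝 g) ↔ ∀ x, Tendsto (fun i => f i x) F (𝓝 (g x)) := by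
  refine ⟨fun h x => ((continuous_isometryEquiv_apply x).tendsto g).comp h, fun h => ?_⟩
  rw [nhds_induced, tendsto_comap_iff,
    ContinuousMap.tendsto_iff_forall_isCompact_tendstoUniformlyOn]
  refine fun K hK => Metric.tendstoUniformlyOn_iff.2 fun ε hε => ?_
  obtain ⟨t, -, ht, hcov⟩ := hK.finite_cover_balls (e := ε / 3) (by positivity)
  have hev : ∀ᶠ i in F, ∀ y ∈ t, dist (f i y) (g y) < ε / 3 :=
    (eventually_all_finite ht).2 fun y _ => Metric.tendsto_nhds.1 (h y) _ (by positivity)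
  filter_upwards [hev] with i hi x hx
  obtain ⟨y, hy, hxy⟩ := mem_iUnion₂.1 (hcov hx)
  calc dist (g x) (f i x) ≤ dist (g x) (g y) + dist (g y) (f i y) + dist (f i y) (f i x) :=
        dist_triangle4 _ _ _ _
    _ = dist x y + dist (f i y) (g y) + dist x y := by
        rw [g.dist_eq, (f i).dist_eq, dist_comm (g y), dist_comm y x]
    _ < ε := by linarith [hi y hy, Metric.mem_ball.1 hxy]

instance continuousSMul_isometryEquiv : ContinuousSMul (X ≃ᵢ X) X where
  continuous_smul := by
    refine continuous_iff_continuousAt.2 fun p => tendsto_iff_dist_tendsto_zero.2 ?_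
    have hfst := tendsto_iff_dist_tendsto_zero.1
      (tendsto_isometryEquiv_iff.1 (continuous_fst.tendsto p) p.2)
    have hsnd := tendsto_iff_dist_tendsto_zero.1 (continuous_snd.tendsto p)
    refine squeeze_zero (fun _ => dist_nonneg) (fun q => ?_)
      (by simpa only [add_zero] using hsnd.add hfst)
    calc dist (q.1 q.2) (p.1 p.2) ≤ dist (q.1 q.2) (q.1 p.2) + dist (q.1 p.2) (p.1 p.2) :=
          dist_triangle _ _ _
      _ = dist q.2 p.2 + dist (q.1 p.2) (p.1 p.2) := by rw [q.1.dist_eq]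

theorem dist_inv_apply_left (g : X ≃ᵢ X) (x y : X) : dist (g⁻¹ x) y = dist (g y) x := by
  rw [← g.dist_eq, dist_comm]
  exact congrArg _ (g.apply_symm_apply x)

instance isTopologicalGroup_isometryEquiv : IsTopologicalGroup (X ≃ᵢ X) where
  continuous_mul := continuous_iff_continuousAt.2 fun p => tendsto_isometryEquiv_iff.2 fun x =>
    (continuous_fst.smul ((continuous_isometryEquiv_apply x).comp continuous_snd)).tendsto p
  continuous_inv := by
    refine continuous_iff_continuousAt.2 fun g => tendsto_isometryEquiv_iff.2 fun x =>
      tendsto_iff_dist_tendsto_zero.2 ?_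
    have hg : g (g⁻¹ x) = x := g.apply_symm_apply x
    simpa only [hg, dist_inv_apply_left] using tendsto_iff_dist_tendsto_zero.1
      ((continuous_isometryEquiv_apply (g⁻¹ x)).tendsto g)

theorem exists_tendsto_of_dist_apply_le [ProperSpace X] {ι : Type*} (U : Ultrafilter ι)
    {f : ι → X ≃ᵢ X} {x : X} {C : ℝ} (h : ∀ᶠ i in U, dist (f i x) x ≤ C) :
    ∃ g, Tendsto f U (𝓝 g) := by
  have hfwd (y : X) : ∃ z, Tendsto (fun i => f i y) U (𝓝 z) := by
    refine exists_tendsto_of_eventually_dist_le U (x := x) (C := dist y x + C) ?_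
    filter_upwards [h] with i hi
    linarith [dist_triangle (f i y) (f i x) x, (f i).dist_eq y x]
  have hbwd (y : X) : ∃ z, Tendsto (fun i => (f i)⁻¹ y) U (𝓝 z) := by
    refine exists_tendsto_of_eventually_dist_le U (x := x) (C := C + dist x y) ?_
    filter_upwards [h] with i hi
    rw [dist_inv_apply_left]
    linarith [dist_triangle (f i x) x y]
  choose F hF using hfwd
  choose F' hF' using hbwd
  have hiso : Isometry F := Isometry.of_dist_eq fun y z =>
    tendsto_nhds_unique ((hF y).dist (hF z)) (by simp [IsometryEquiv.dist_eq])
  have hinv (y : X) : F (F' y) = y := by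
    have hlim : Tendsto (fun i => dist ((f i)⁻¹ y) (F' y)) U (𝓝 (dist (F (F' y)) y)) :=
      ((hF (F' y)).dist tendsto_const_nhds).congr fun i => (dist_inv_apply_left _ _ _).symm
    rw [← dist_eq_zero, tendsto_nhds_unique hlim ((hF' y).dist tendsto_const_nhds), dist_self]
  exact ⟨IsometryEquiv.mk' F F' hinv hiso, tendsto_isometryEquiv_iff.2 hF⟩

instance properSMul_isometryEquiv [ProperSpace X] : ProperSMul (X ≃ᵢ X) X := by
  refine properSMul_iff_continuousSMul_ultrafilter_tendsto_t2.2 ⟨inferInstance, ?_⟩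
  intro U x₁ x₂ hU
  have hx₁ := hU.fst_nhds.eventually (Metric.closedBall_mem_nhds x₁ one_pos)
  have hx₂ := hU.snd_nhds.eventually (Metric.closedBall_mem_nhds x₂ one_pos)
  refine exists_tendsto_of_dist_apply_le U (x := x₂) (C := 1 + 1 + dist x₁ x₂) ?_
  filter_upwards [hx₁, hx₂] with p hp₁ hp₂
  calc dist (p.1 x₂) x₂ ≤ dist (p.1 x₂) (p.1 p.2) + dist (p.1 p.2) x₁ + dist x₁ x₂ :=
        dist_triangle4 _ _ _ _
    _ ≤ 1 + 1 + dist x₁ x₂ := by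
        rw [p.1.dist_eq, dist_comm x₂]
        gcongr
        exact hp₁

theorem IsCAT0.continuousSMul_boundary [ProperSpace X] (hX : IsCAT0 X) :
    ContinuousSMul (X ≃ᵢ X) (Boundary X) where
  continuous_smul := by
    refine continuous_iff_continuousAt.2 fun p => ?_
    obtain ⟨c⟩ := p.2
    have hasymp (q : (X ≃ᵢ X) × Boundary X) :
        (hX.ray (c 0) q.2).map q.1 ≈ hX.ray (c 0) (q.1 • q.2) := by
      rw [← GeodesicRay.endpoint_eq_iff, ← smul_endpoint, hX.endpoint_ray, hX.endpoint_ray]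
    refine (hX.tendsto_boundary_iff (c 0)).2 fun t =>
      hX.tendsto_asymptotic_ray (fun s => ?_) hasymp (hasymp p) ?_ t
    · exact (continuous_fst.smul ((hX.continuous_ray (c 0) s).comp continuous_snd)).tendsto p
    · simpa only [hX.ray_zero] using tendsto_const_nhds

end Isometries

/-! ### The limit set -/

section LimitSet

variable {X : Type*} [MetricSpace X] {G : Subgroup (X ≃ᵢ X)}

theorem accPt_ideal_iff {ξ : Boundary X} {S : Set X} :
    AccPt (Bordification.ideal ξ) (𝓟 (Bordification.point '' S)) ↔
      Bordification.ideal ξ ∈ closure (Bordification.point '' S) := by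
  have : Bordification.point '' S \ {Bordification.ideal ξ} = Bordification.point '' S :=
    sdiff_singleton_eq_self (by simp)
  rw [accPt_principal_iff_clusterPt, this, mem_closure_iff_clusterPt]

theorem mem_limitSet_iff {ξ : Boundary X} : ξ ∈ limitSet G ↔
    ∃ x : X, Bordification.ideal ξ ∈ closure (Bordification.point '' MulAction.orbit G x) := by
  have horbit (x : X) : {z | ∃ g ∈ G, z = Bordification.point (g x)} =
      Bordification.point '' MulAction.orbit G x := by
    ext z
    constructor
    · rintro ⟨g, hg, rfl⟩
      exact ⟨g x, ⟨⟨g, hg⟩, rfl⟩, rfl⟩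
    · rintro ⟨_, ⟨g, rfl⟩, rfl⟩
      exact ⟨g, g.2, rfl⟩
  change (∃ x : X, AccPt (Bordification.ideal ξ)
    (𝓟 {z | ∃ g ∈ G, z = Bordification.point (g x)})) ↔ _
  simp only [horbit, accPt_ideal_iff]

theorem isClosed_limitSet [MulAction.IsPretransitive G (limitSet G)] :
    IsClosed (limitSet G : Set (Boundary X)) := by
  rcases (limitSet G : Set (Boundary X)).eq_empty_or_nonempty with he | ⟨ξ, hξ⟩
  · rw [he]
    exact isClosed_empty
  obtain ⟨x, hx⟩ := mem_limitSet_iff.1 hξ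
  suffices h : (limitSet G : Set (Boundary X)) =
      Bordification.ideal ⁻¹' closure (Bordification.point '' MulAction.orbit G x) by
    rw [h]
    exact isClosed_closure.preimage continuous_induced_dom
  refine Subset.antisymm (fun η hη => ?_) fun η hη => mem_limitSet_iff.2 ⟨x, hη⟩
  obtain ⟨g, hg⟩ := MulAction.exists_smul_eq G (⟨ξ, hξ⟩ : limitSet G) ⟨η, hη⟩
  obtain rfl : (g : X ≃ᵢ X) • ξ = η := congrArg Subtype.val hg
  refine closure_mono ?_ (image_closure_subset_closure_image
    (Bordification.continuous_map (g : X ≃ᵢ X)) (mem_image_of_mem _ hx))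
  rintro _ ⟨_, ⟨y, hy, rfl⟩, rfl⟩
  exact ⟨g • y, MulAction.mem_orbit_of_mem_orbit g hy, rfl⟩

theorem IsCAT0.tendsto_point_ray [ProperSpace X] (hX : IsCAT0 X) (c : GeodesicRay X) :
    Tendsto (fun s => Bordification.point (c s)) atTop (𝓝 (Bordification.ideal c.endpoint)) := by
  refine TopologicalSpace.tendsto_nhds_generateFrom_iff.2 ?_
  rintro U (⟨V, -, rfl⟩ | ⟨d, r, ε, -, -, rfl⟩) hU
  · simp at hU
  rw [hX.ideal_mem_coneNhd] at hU
  set c' := hX.ray (d 0) c.endpoint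
  have hc'0 : c' 0 = d 0 := hX.ray_zero _ _
  have hasymp : c ≈ c' := GeodesicRay.endpoint_eq_iff.1 (hX.endpoint_ray _ _).symm
  have hℓ := c.tendsto_dist_atTop (d 0)
  have hsmall : Tendsto (fun s => 2 * r * dist (c 0) (c' 0) / dist (d 0) (c s)) atTop (𝓝 0) :=
    tendsto_const_nhds.div_atTop hℓ
  filter_upwards [hℓ.eventually_gt_atTop r, hsmall.eventually_lt_const (sub_pos.2 hU)]
    with s hrs hs
  have hpos : 0 < dist (d 0) (c s) := r.coe_nonneg.trans_lt hrs
  obtain ⟨p, hp⟩ := hX.geodesic.exists_between (d 0) (c s) (t := r / dist (d 0) (c s))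
    ⟨by positivity, (div_le_one hpos).2 hrs.le⟩
  have hp0 : dist (d 0) p = r := by rw [hp.dist_left, div_mul_cancel₀ _ hpos.ne']
  refine Or.inl ⟨c s, rfl, hrs, p, hp0, by linarith [hp.dist_add_dist], ?_⟩
  have hpc' : dist p (c' r) ≤ 2 * r * dist (c 0) (c' 0) / dist (d 0) (c s) :=
    calc dist p (c' r) ≤ dist (d 0) (c' 0) + 2 * (r / dist (d 0) (c s)) * dist (c s) (c' s) :=
          hX.dist_apply_ray_le c' hp hp0 s
      _ ≤ 0 + 2 * (r / dist (d 0) (c s)) * dist (c 0) (c' 0) := by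
          rw [hc'0, dist_self, ← hc'0]
          gcongr
          exact hX.dist_ray_le hasymp s
      _ = _ := by ring
  linarith [dist_triangle p (c' r) (d r)]

theorem IsCAT0.endpoint_mem_limitSet [ProperSpace X] (hX : IsCAT0 X) (c : GeodesicRay X) {x : X}
    (h : ∃ᶠ s in atTop, c s ∈ MulAction.orbit G x) : c.endpoint ∈ limitSet G :=
  mem_limitSet_iff.2 ⟨x, mem_closure_of_frequently_of_tendsto
    (h.mono fun _ => mem_image_of_mem _) (hX.tendsto_point_ray c)⟩

/-- The line with the opposite orientation. -/
def GeodesicLine.reverse (γ : GeodesicLine X) : GeodesicLine X :=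
  ⟨fun t => γ (-t), γ.isometry.comp (IsometryEquiv.neg ℝ).isometry⟩

theorem GeodesicLine.reverse_apply (γ : GeodesicLine X) (t : ℝ) : γ.reverse t = γ (-t) := rfl

theorem GeodesicLine.posEnd_reverse (γ : GeodesicLine X) : γ.reverse.posEnd = γ.negEnd := rfl

theorem GeodesicLine.reverse_reverse (γ : GeodesicLine X) : γ.reverse.reverse = γ := by
  cases γ
  simp [GeodesicLine.reverse]

theorem GeodesicLine.negEnd_reverse (γ : GeodesicLine X) : γ.reverse.negEnd = γ.posEnd := by
  rw [← γ.reverse.posEnd_reverse, γ.reverse_reverse]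

theorem GeodesicLine.range_reverse (γ : GeodesicLine X) : range γ.reverse = range γ :=
  neg_surjective.range_comp γ

theorem GeodesicLine.pow_apply_of_translate {g : X ≃ᵢ X} {γ : GeodesicLine X} {τ : ℝ}
    (h : ∀ t, g (γ t) = γ (t + τ)) (n : ℕ) (t : ℝ) : (g ^ n) (γ t) = γ (t + n * τ) := by
  induction n with
  | zero => simp
  | succ n ih =>
    rw [pow_succ', IsometryEquiv.mul_apply, ih, h]
    push_cast
    ring_nf

theorem IsCAT0.posEnd_mem_limitSet [ProperSpace X] (hX : IsCAT0 X) {g : X ≃ᵢ X} (hg : g ∈ G)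
    {γ : GeodesicLine X} {τ : ℝ} (hτ : 0 < τ) (h : ∀ t, g (γ t) = γ (t + τ)) :
    γ.posEnd ∈ limitSet G := by
  refine hX.endpoint_mem_limitSet _ (x := γ 0) (frequently_atTop.2 fun s => ?_)
  obtain ⟨m, hm⟩ := exists_nat_ge (s / τ)
  refine ⟨⟨m * τ, by positivity⟩, (div_le_iff₀ hτ).1 hm, ⟨g ^ m, G.pow_mem hg m⟩, ?_⟩
  change (g ^ m) (γ 0) = γ (m * τ)
  rw [γ.pow_apply_of_translate h, zero_add]

theorem IsCAT0.negEnd_mem_limitSet [ProperSpace X] (hX : IsCAT0 X) {g : X ≃ᵢ X} (hg : g ∈ G)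
    {γ : GeodesicLine X} {τ : ℝ} (hτ : 0 < τ) (h : ∀ t, g (γ t) = γ (t + τ)) :
    γ.negEnd ∈ limitSet G := by
  rw [← γ.posEnd_reverse]
  refine hX.posEnd_mem_limitSet (G.inv_mem hg) hτ fun t => ?_
  have := h (-(t + τ))
  rw [neg_add, neg_add_cancel_right] at this
  rw [γ.reverse_apply, γ.reverse_apply, neg_add, ← this]
  exact g.symm_apply_apply _

end LimitSet

/-! ### Lines and their endpoints -/

section Lines

variable {X : Type*} [MetricSpace X]

theorem IsCAT0.endpoint_eq_of_frequently_dist_le (hX : IsCAT0 X) {c d : GeodesicRay X} {C : ℝ}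
    (h : ∃ᶠ t in atTop, ∃ s, dist (c t) (d s) ≤ C) : c.endpoint = d.endpoint := by
  refine GeodesicRay.endpoint_eq_iff.2 ⟨dist (c 0) (d 0) + 2 * 1 * C, fun u => ?_⟩
  obtain ⟨t, ⟨s, hs⟩, hut, ht⟩ :=
    (h.and_eventually ((eventually_ge_atTop u).and (eventually_gt_atTop 0))).exists
  have hbetween := c.between_of_le hut ht
  refine (hX.dist_apply_ray_le d hbetween (c.dist_zero_apply u) s).trans ?_
  gcongr
  exact hbetween.mem_Icc.2

theorem GeodesicLine.posEnd_eq_iff {γ γ' : GeodesicLine X} :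
    γ.posEnd = γ'.posEnd ↔ ∃ C, ∀ t, 0 ≤ t → dist (γ t) (γ' t) ≤ C :=
  GeodesicRay.endpoint_eq_iff.trans
    ⟨fun ⟨C, h⟩ => ⟨C, fun t ht => h ⟨t, ht⟩⟩, fun ⟨C, h⟩ => ⟨C, fun t => h t t.2⟩⟩

theorem GeodesicLine.negEnd_eq_iff {γ γ' : GeodesicLine X} :
    γ.negEnd = γ'.negEnd ↔ ∃ C, ∀ t, t ≤ 0 → dist (γ t) (γ' t) ≤ C := by
  rw [← γ.posEnd_reverse, ← γ'.posEnd_reverse, posEnd_eq_iff]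
  refine exists_congr fun C => ⟨fun h t ht => ?_, fun h t ht => h (-t) (neg_nonpos.2 ht)⟩
  simpa only [reverse_apply, neg_neg] using h (-t) (neg_nonneg.2 ht)

theorem GeodesicLine.negEnd_ne_posEnd (γ : GeodesicLine X) : γ.negEnd ≠ γ.posEnd := by
  rw [← γ.posEnd_reverse, Ne, posEnd_eq_iff]
  rintro ⟨C, h⟩
  have hC : 0 ≤ |C| + 1 := by positivity
  have hle := h (|C| + 1) hC
  rw [γ.reverse_apply, γ.dist_eq, abs_sub_comm, sub_neg_eq_add, abs_of_nonneg (by linarith)] at hle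
  linarith [le_abs_self C]

theorem IsCAT0.eventually_forall_lt_dist (hX : IsCAT0 X) {α β : GeodesicLine X}
    (hpos : α.posEnd ≠ β.posEnd) (hneg : α.posEnd ≠ β.negEnd) (C : ℝ) :
    ∀ᶠ t in atTop, ∀ s, C < dist (α t) (β s) := by
  rw [← NNReal.map_coe_atTop, eventually_map]
  by_contra hfreq
  rw [not_eventually] at hfreq
  have hclose : ∃ᶠ t : ℝ≥0 in atTop,
      (∃ s : ℝ≥0, dist (α t) (β s) ≤ C) ∨ ∃ s : ℝ≥0, dist (α t) (β (-s)) ≤ C := by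
    refine hfreq.mono fun t ht => ?_
    push Not at ht
    obtain ⟨s, hs⟩ := ht
    rcases le_total 0 s with h0 | h0
    · exact Or.inl ⟨⟨s, h0⟩, hs⟩
    · exact Or.inr ⟨(-s).toNNReal, by rwa [Real.coe_toNNReal _ (neg_nonneg.2 h0), neg_neg]⟩
  rcases frequently_or_distrib.1 hclose with h | h
  · exact hpos (hX.endpoint_eq_of_frequently_dist_le h)
  · exact hneg (hX.endpoint_eq_of_frequently_dist_le h)

theorem IsCAT0.infDist_eq_of_parallel (hX : IsCAT0 X) {γ γ' : GeodesicLine X}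
    (hneg : γ.negEnd = γ'.negEnd) (hpos : γ.posEnd = γ'.posEnd) (s t : ℝ) :
    Metric.infDist (γ s) (range γ') = Metric.infDist (γ t) (range γ') := by
  obtain ⟨C₁, hC₁⟩ := GeodesicLine.posEnd_eq_iff.1 hpos
  obtain ⟨C₂, hC₂⟩ := GeodesicLine.negEnd_eq_iff.1 hneg
  refine eq_of_convexOn_univ_of_forall_le
    ((hX.geodesicallyConvex_infDist γ').convexOn_comp_line γ) (C := max C₁ C₂) (fun u => ?_) s t
  refine (γ'.infDist_le_dist _ u).trans ?_
  rcases le_total 0 u with hu | hu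
  · exact (hC₁ u hu).trans (le_max_left _ _)
  · exact (hC₂ u hu).trans (le_max_right _ _)

theorem GeodesicLine.abs_sub_le_two_mul_dist (γ : GeodesicLine X) {x : X} {q : ℝ}
    (hq : Metric.infDist x (range γ) = dist x (γ q)) (t : ℝ) : |q - t| ≤ 2 * dist x (γ t) := by
  have hle := hq.symm.trans_le (γ.infDist_le_dist x t)
  rw [← γ.dist_eq]
  linarith [dist_triangle_left (γ q) (γ t) x]

/-- The image of a line under an isometry. -/
def GeodesicLine.map (g : X ≃ᵢ X) (γ : GeodesicLine X) : GeodesicLine X :=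
  ⟨fun t => g (γ t), g.isometry.comp γ.isometry⟩

theorem GeodesicLine.negEnd_map (g : X ≃ᵢ X) (γ : GeodesicLine X) :
    (γ.map g).negEnd = g • γ.negEnd := rfl

theorem GeodesicLine.posEnd_map (g : X ≃ᵢ X) (γ : GeodesicLine X) :
    (γ.map g).posEnd = g • γ.posEnd := rfl

theorem GeodesicLine.map_map_inv (g : X ≃ᵢ X) (γ : GeodesicLine X) : (γ.map g⁻¹).map g = γ := by
  obtain ⟨f, hf⟩ := γ
  have h : (fun t => g (g⁻¹ (f t))) = f := funext fun t => g.apply_symm_apply (f t)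
  simp only [GeodesicLine.map, h]

theorem GeodesicLine.range_map (g : X ≃ᵢ X) (γ : GeodesicLine X) :
    range (γ.map g) = g '' range γ := range_comp g γ

theorem GeodesicLine.infDist_map (g : X ≃ᵢ X) (γ : GeodesicLine X) (x : X) :
    Metric.infDist (g x) (range (γ.map g)) = Metric.infDist x (range γ) := by
  rw [γ.range_map, Metric.infDist_image g.isometry]

end Lines

/-! ### Contracting lines -/

section Contracting

variable {X : Type*} [MetricSpace X] {B : ℝ} {γ σ ρ γ' : GeodesicLine X}

theorem projectionImage_image (g : X ≃ᵢ X) (S K : Set X) :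
    projectionImage (g '' S) (g '' K) = g '' projectionImage S K := by
  ext p
  simp only [projectionImage, mem_ofPred_eq, mem_image, exists_exists_and_eq_and,
    forall_exists_index, and_imp, forall_apply_eq_imp_iff₂]
  constructor
  · rintro ⟨⟨s, hs, rfl⟩, x, hx, hmin⟩
    exact ⟨s, ⟨hs, x, hx, by simpa only [g.dist_eq] using hmin⟩, rfl⟩
  · rintro ⟨s, ⟨hs, x, hx, hmin⟩, rfl⟩
    exact ⟨⟨s, hs, rfl⟩, x, hx, by simpa only [g.dist_eq] using hmin⟩

theorem IsContracting.map (hγ : IsContracting B γ) (g : X ≃ᵢ X) : IsContracting B (γ.map g) := by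
  intro y r hdisj
  obtain ⟨x, rfl⟩ := g.surjective y
  rw [← g.image_closedBall, γ.range_map, disjoint_image_iff g.injective] at hdisj
  rw [← g.image_closedBall, γ.range_map, projectionImage_image]
  rintro _ ⟨p, hp, rfl⟩ _ ⟨q, hq, rfl⟩
  rw [g.dist_eq]
  exact hγ x r hdisj p hp q hq

theorem IsContracting.reverse (hγ : IsContracting B γ) : IsContracting B γ.reverse := by
  rwa [IsContracting, γ.range_reverse]

theorem IsContracting.abs_sub_le_of_dist_lt (hγ : IsContracting B γ) {x y : X} {p q : ℝ}
    (hp : Metric.infDist x (range γ) = dist x (γ p))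
    (hq : Metric.infDist y (range γ) = dist y (γ q))
    (hxy : dist x y < Metric.infDist x (range γ)) : |p - q| ≤ B := by
  have hmem {z : X} {s : ℝ} (hz : z ∈ Metric.closedBall x (dist x y))
      (hs : Metric.infDist z (range γ) = dist z (γ s)) :
      γ s ∈ projectionImage (range γ) (Metric.closedBall x (dist x y)) :=
    ⟨mem_range_self s, z, hz, fun w hw => hs.symm.trans_le (Metric.infDist_le_dist_of_mem hw)⟩
  rw [← γ.dist_eq]
  refine hγ x (dist x y) (Metric.disjoint_closedBall_of_lt_infDist hxy) _
    (hmem (Metric.mem_closedBall_self dist_nonneg) hp) _ (hmem ?_ hq)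
  rw [Metric.mem_closedBall, dist_comm]

theorem IsContracting.abs_sub_le_add_one_mul (hγ : IsContracting B γ) (hB : 0 < B) {b : ℝ} (n : ℕ) :
    ∀ {a : ℝ}, a ≤ b → (∀ s ∈ Icc a b, 2 * B < Metric.infDist (σ s) (range γ)) →
    b - a ≤ (n + 1) * (2 * B) → ∀ {p q : ℝ}, Metric.infDist (σ a) (range γ) = dist (σ a) (γ p) →
    Metric.infDist (σ b) (range γ) = dist (σ b) (γ q) → |p - q| ≤ (n + 1) * B := by
  have hstep {a c p r : ℝ} (hac : a ≤ c) (hca : c - a ≤ 2 * B)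
      (hfar : 2 * B < Metric.infDist (σ a) (range γ))
      (hp : Metric.infDist (σ a) (range γ) = dist (σ a) (γ p))
      (hr : Metric.infDist (σ c) (range γ) = dist (σ c) (γ r)) : |p - r| ≤ B := by
    refine hγ.abs_sub_le_of_dist_lt hp hr ?_
    rw [σ.dist_eq, abs_sub_comm, abs_of_nonneg (sub_nonneg.2 hac)]
    exact hca.trans_lt hfar
  induction n with
  | zero =>
    intro a hab hfar hlen p q hp hq
    rw [Nat.cast_zero, zero_add, one_mul] at hlen ⊢
    exact hstep hab hlen (hfar a (left_mem_Icc.2 hab)) hp hq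
  | succ n ih =>
    intro a hab hfar hlen p q hp hq
    push_cast at hlen ⊢
    set c := min b (a + 2 * B)
    have hac : a ≤ c := le_min hab (by linarith)
    have hcb : c ≤ b := min_le_left _ _
    have hbc : b - c ≤ (n + 1) * (2 * B) := by
      rw [sub_le_comm]
      exact le_min (sub_le_self b (by positivity)) (by linarith)
    obtain ⟨r, hr⟩ := γ.exists_infDist_eq_dist (σ c)
    have hpr := hstep hac (by linarith [min_le_right b (a + 2 * B)])
      (hfar a (left_mem_Icc.2 hab)) hp hr
    have hrq := ih hcb (fun s hs => hfar s ⟨hac.trans hs.1, hs.2⟩) hbc hr hq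
    linarith [abs_sub_le p r q]

theorem IsContracting.abs_sub_le_half_add (hγ : IsContracting B γ) (hB : 0 < B) {a b : ℝ}
    (hab : a ≤ b) (hfar : ∀ s ∈ Icc a b, 2 * B < Metric.infDist (σ s) (range γ)) {p q : ℝ}
    (hp : Metric.infDist (σ a) (range γ) = dist (σ a) (γ p))
    (hq : Metric.infDist (σ b) (range γ) = dist (σ b) (γ q)) : |p - q| ≤ (b - a) / 2 + B := by
  set n := ⌊(b - a) / (2 * B)⌋₊
  have hlt : b - a < (n + 1) * (2 * B) := (div_lt_iff₀ (by positivity)).1 (Nat.lt_floor_add_one _)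
  have hle : n * (2 * B) ≤ b - a :=
    (le_div_iff₀ (by positivity)).1 (Nat.floor_le (div_nonneg (sub_nonneg.2 hab) (by positivity)))
  linarith [hγ.abs_sub_le_add_one_mul hB n hab hfar hlt.le hp hq]

/- Each end of the segment may be moved towards the middle almost by its distance to `γ` at the
cost `B`; what remains has length at most about `|p - q|` and is contracted by the factor `2`. -/
theorem IsContracting.abs_sub_le_of_forall_lt_infDist (hγ : IsContracting B γ) (hB : 0 < B)
    {a b : ℝ} (hab : a ≤ b) (hfar : ∀ s ∈ Icc a b, 2 * B < Metric.infDist (σ s) (range γ))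
    {p q : ℝ} (hp : Metric.infDist (σ a) (range γ) = dist (σ a) (γ p))
    (hq : Metric.infDist (σ b) (range γ) = dist (σ b) (γ q)) : |p - q| ≤ 8 * B := by
  set δa := Metric.infDist (σ a) (range γ)
  set δb := Metric.infDist (σ b) (range γ)
  have hδa : 2 * B < δa := hfar a (left_mem_Icc.2 hab)
  have hδb : 2 * B < δb := hfar b (right_mem_Icc.2 hab)
  have hlen : b - a ≤ δa + |p - q| + δb := by
    have htri := dist_triangle4 (σ a) (γ p) (γ q) (σ b)
    rwa [σ.dist_eq, γ.dist_eq, dist_comm (γ q), ← hp, ← hq, abs_sub_comm a,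
      abs_of_nonneg (sub_nonneg.2 hab)] at htri
  set a' := min b (a + (δa - B))
  set b' := max a' (b - (δb - B))
  have haa' : a ≤ a' := le_min hab (by linarith)
  have ha'b : a' ≤ b := min_le_left _ _
  have ha'b' : a' ≤ b' := le_max_left _ _
  have hb'b : b' ≤ b := max_le ha'b (by linarith)
  have hmiddle : b' - a' ≤ |p - q| + 2 * B := by
    have := abs_nonneg (p - q)
    rcases max_choice a' (b - (δb - B)) with h | h <;>
      rcases min_choice b (a + (δa - B)) with h' | h' <;> linarith
  obtain ⟨r, hr⟩ := γ.exists_infDist_eq_dist (σ a')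
  obtain ⟨u, hu⟩ := γ.exists_infDist_eq_dist (σ b')
  have hpr : |p - r| ≤ B := by
    refine hγ.abs_sub_le_of_dist_lt hp hr ?_
    rw [σ.dist_eq, abs_sub_comm, abs_of_nonneg (sub_nonneg.2 haa')]
    linarith [min_le_right b (a + (δa - B))]
  have hqu : |q - u| ≤ B := by
    refine hγ.abs_sub_le_of_dist_lt hq hu ?_
    rw [σ.dist_eq, abs_of_nonneg (sub_nonneg.2 hb'b)]
    linarith [le_max_right a' (b - (δb - B))]
  have hru := hγ.abs_sub_le_half_add hB ha'b'
    (fun s hs => hfar s ⟨haa'.trans hs.1, hs.2.trans hb'b⟩) hr hu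
  rw [abs_sub_comm] at hqu
  linarith [abs_sub_le p r q, abs_sub_le r u q]

theorem exists_first_eq_of_continuous {f : ℝ → ℝ} (hf : Continuous f) {a b v : ℝ}
    (ha : v ≤ f a) (hab : a ≤ b) (hb : f b ≤ v) :
    ∃ c ∈ Icc a b, f c = v ∧ ∀ s ∈ Icc a c, v ≤ f s := by
  have hne : (Icc a b ∩ f ⁻¹' {v}).Nonempty := by
    obtain ⟨c, hc, hcv⟩ := intermediate_value_Icc' hab hf.continuousOn ⟨hb, ha⟩
    exact ⟨c, hc, hcv⟩
  obtain ⟨c, ⟨hc, hcv⟩, hleast⟩ :=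
    (isCompact_Icc.inter_right (isClosed_singleton.preimage hf)).exists_isLeast hne
  refine ⟨c, hc, hcv, fun s hs => ?_⟩
  by_contra! hlt
  obtain ⟨d, hd, hdv⟩ := intermediate_value_Icc' hs.1 hf.continuousOn ⟨hlt.le, ha⟩
  have hcs : c ≤ s := (hleast ⟨⟨hd.1, hd.2.trans (hs.2.trans hc.2)⟩, hdv⟩).trans hd.2
  rw [hs.2.antisymm hcs, hcv] at hlt
  exact lt_irrefl _ hlt

theorem IsContracting.exists_dist_le (hγ : IsContracting B γ) (hB : 0 < B) {a b : ℝ} (hab : a ≤ b)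
    {p q : ℝ} (hp : Metric.infDist (σ a) (range γ) = dist (σ a) (γ p))
    (hq : Metric.infDist (σ b) (range γ) = dist (σ b) (γ q)) (hpq : 8 * B < |p - q|) :
    ∃ s, dist (σ s) (γ p) ≤ 11 * B := by
  set f : ℝ → ℝ := fun s => Metric.infDist (σ s) (range γ)
  have hf : Continuous f := (Metric.continuous_infDist_pt _).comp σ.isometry.continuous
  obtain ⟨c, hc, hfc⟩ : ∃ c ∈ Icc a b, f c ≤ 3 * B := by
    by_contra! hfar
    refine hpq.not_ge (hγ.abs_sub_le_of_forall_lt_infDist hB hab (fun s hs => ?_) hp hq)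
    linarith [hfar s hs]
  rcases le_total (f a) (3 * B) with ha | ha
  · exact ⟨a, by linarith⟩
  obtain ⟨d, hd, hfd, hfar⟩ := exists_first_eq_of_continuous hf ha hc.1 hfc
  obtain ⟨r, hr⟩ := γ.exists_infDist_eq_dist (σ d)
  have hpr := hγ.abs_sub_le_of_forall_lt_infDist hB hd.1
    (fun s hs => by linarith [hfar s hs] : ∀ s ∈ Icc a d, 2 * B < f s) hp hr
  have htri := dist_triangle (σ d) (γ r) (γ p)
  rw [γ.dist_eq, abs_sub_comm] at htri
  exact ⟨d, by linarith⟩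

theorem IsContracting.exists_dist_le_of_posEnd_eq (hγ : IsContracting B γ) (hB : 0 < B)
    (hσ : σ.posEnd = γ.posEnd) {a p : ℝ} (hp : Metric.infDist (σ a) (range γ) = dist (σ a) (γ p)) :
    ∃ s, dist (σ s) (γ p) ≤ 11 * B := by
  obtain ⟨M, hM⟩ := GeodesicLine.posEnd_eq_iff.1 hσ
  obtain ⟨T, haT, hT, hpT⟩ : ∃ T, a ≤ T ∧ 0 ≤ T ∧ p + 8 * B + 2 * M < T :=
    ((eventually_ge_atTop a).and ((eventually_ge_atTop 0).and (eventually_gt_atTop _))).exists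
  obtain ⟨q, hq⟩ := γ.exists_infDist_eq_dist (σ T)
  have hqT := (abs_le.1 (γ.abs_sub_le_two_mul_dist hq T)).1
  refine hγ.exists_dist_le hB haT hp hq ?_
  rw [abs_sub_comm]
  exact lt_of_lt_of_le (by linarith [hM T hT]) (le_abs_self _)

/- Far out at their common endpoint the two sides `σ` and `ρ` are much closer to each other than to
the contracting side `γ`, so they have nearby projections to `γ`; both sides pass close to these. -/
theorem IsContracting.exists_mem_range_infDist_le (hX : IsCAT0 X) (hγ : IsContracting B γ)
    (hB : 0 < B) (hσγ : σ.posEnd = γ.posEnd) (hργ : ρ.posEnd = γ.negEnd)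
    (hσρ : σ.negEnd = ρ.negEnd) (hneg : σ.negEnd ≠ γ.negEnd) (hpos : σ.negEnd ≠ γ.posEnd) :
    ∃ x ∈ range γ, Metric.infDist x (range σ) ≤ 12 * B ∧ Metric.infDist x (range ρ) ≤ 12 * B := by
  obtain ⟨M, hM⟩ := GeodesicLine.negEnd_eq_iff.1 hσρ
  obtain ⟨S, hS, hS0⟩ := ((hX.eventually_forall_lt_dist (α := σ.reverse) hpos hneg M).and
    (eventually_ge_atTop 0)).exists
  obtain ⟨p, hp⟩ := γ.exists_infDist_eq_dist (σ (-S))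
  obtain ⟨p', hp'⟩ := γ.exists_infDist_eq_dist (ρ (-S))
  have hpp' : |p - p'| ≤ B :=
    hγ.abs_sub_le_of_dist_lt hp hp' (((hM _ (neg_nonpos.2 hS0)).trans_lt (hS p)).trans_eq hp.symm)
  obtain ⟨s, hs⟩ := hγ.exists_dist_le_of_posEnd_eq hB hσγ hp
  obtain ⟨t, ht⟩ := hγ.reverse.exists_dist_le_of_posEnd_eq hB hργ (a := -S) (p := -p')
    (by rwa [γ.range_reverse, γ.reverse_apply, neg_neg])
  rw [γ.reverse_apply, neg_neg, dist_comm] at ht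
  rw [dist_comm] at hs
  refine ⟨γ p, mem_range_self p, (σ.infDist_le_dist _ s).trans (by linarith),
    (ρ.infDist_le_dist _ t).trans ?_⟩
  have htri := dist_triangle (γ p) (γ p') (ρ t)
  rw [γ.dist_eq] at htri
  linarith

/- Otherwise `γ'` would stay outside the `3 * B`-neighbourhood of `γ`, and hence have a bounded
projection. -/
theorem IsContracting.infDist_apply_le_of_parallel (hX : IsCAT0 X) (hγ : IsContracting B γ)
    (hB : 0 < B) (hneg : γ'.negEnd = γ.negEnd) (hpos : γ'.posEnd = γ.posEnd) (t : ℝ) :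
    Metric.infDist (γ' t) (range γ) ≤ 3 * B := by
  have hconst (s) := hX.infDist_eq_of_parallel hneg hpos s t
  set w := Metric.infDist (γ' t) (range γ)
  by_contra! hlt
  set T := 2 * w + 9 * B
  have hT : 0 < T := by linarith
  obtain ⟨p, hp⟩ := γ.exists_infDist_eq_dist (γ' 0)
  obtain ⟨q, hq⟩ := γ.exists_infDist_eq_dist (γ' T)
  have hpq := hγ.abs_sub_le_of_forall_lt_infDist hB hT.le
    (fun s _ => by rw [hconst s]; linarith) hp hq
  have htri := dist_triangle4 (γ' 0) (γ p) (γ q) (γ' T)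
  rw [γ'.dist_eq, γ.dist_eq, dist_comm (γ q), ← hp, ← hq, hconst, hconst, zero_sub, abs_neg,
    abs_of_pos hT] at htri
  linarith

theorem IsContracting.infDist_le_add_of_parallel (hX : IsCAT0 X) (hγ : IsContracting B γ)
    (hB : 0 < B) (hneg : γ'.negEnd = γ.negEnd) (hpos : γ'.posEnd = γ.posEnd) (x : X) :
    Metric.infDist x (range γ') ≤ Metric.infDist x (range γ) + 3 * B := by
  obtain ⟨s, hs⟩ := γ.exists_infDist_eq_dist x
  obtain ⟨u, hu⟩ := γ.exists_infDist_eq_dist (γ' 0)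
  have hγs : Metric.infDist (γ s) (range γ') ≤ 3 * B := by
    rw [hX.infDist_eq_of_parallel hneg.symm hpos.symm s u]
    refine (γ'.infDist_le_dist _ 0).trans ?_
    rw [dist_comm, ← hu]
    exact hγ.infDist_apply_le_of_parallel hX hB hneg hpos 0
  calc Metric.infDist x (range γ') ≤ Metric.infDist (γ s) (range γ') + dist x (γ s) :=
        Metric.infDist_le_infDist_add_dist
    _ ≤ Metric.infDist x (range γ) + 3 * B := by linarith

theorem IsCAT0.exists_forall_le_of_infDist_le (hX : IsCAT0 X) (hpos : γ.posEnd ≠ σ.posEnd)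
    (hneg : γ.posEnd ≠ σ.negEnd) (R : ℝ) :
    ∃ N, ∀ x p, dist x (γ p) ≤ R → Metric.infDist x (range σ) ≤ R → p ≤ N := by
  obtain ⟨N, hN⟩ := eventually_atTop.1 (hX.eventually_forall_lt_dist hpos hneg (2 * R))
  refine ⟨N, fun x p hp hx => ?_⟩
  by_contra! hlt
  obtain ⟨s, hs⟩ := σ.exists_infDist_eq_dist x
  linarith [hN p hlt.le s, dist_triangle_left (γ p) (σ s) x]

theorem IsCAT0.isBounded_infDist_le (hX : IsCAT0 X) (hσpos : γ.posEnd ≠ σ.posEnd)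
    (hσneg : γ.posEnd ≠ σ.negEnd) (hρpos : γ.negEnd ≠ ρ.posEnd) (hρneg : γ.negEnd ≠ ρ.negEnd)
    (R : ℝ) : Bornology.IsBounded {x | Metric.infDist x (range γ) ≤ R ∧
      Metric.infDist x (range σ) ≤ R ∧ Metric.infDist x (range ρ) ≤ R} := by
  obtain ⟨N₁, hN₁⟩ := hX.exists_forall_le_of_infDist_le hσpos hσneg R
  obtain ⟨N₂, hN₂⟩ := hX.exists_forall_le_of_infDist_le (γ := γ.reverse) hρpos hρneg R
  refine (Metric.isBounded_closedBall (x := γ 0) (r := R + max N₁ N₂)).subset ?_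
  rintro x ⟨hγx, hσx, hρx⟩
  obtain ⟨p, hp⟩ := γ.exists_infDist_eq_dist x
  rw [hp] at hγx
  have hp₁ : p ≤ N₁ := hN₁ x p hγx hσx
  have hp₂ : -p ≤ N₂ := hN₂ x (-p) (by rwa [γ.reverse_apply, neg_neg]) hρx
  have hp' : |p| ≤ max N₁ N₂ :=
    abs_le'.2 ⟨hp₁.trans (le_max_left _ _), hp₂.trans (le_max_right _ _)⟩
  have htri := dist_triangle x (γ p) (γ 0)
  rw [γ.dist_eq, sub_zero] at htri
  exact Metric.mem_closedBall.2 (by linarith)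

end Contracting

/-! ### Distance to the sides of an ideal polygon -/

section SideDist

variable {X : Type*} [MetricSpace X] {B R : ℝ} {S S' : Set (Boundary X)} {x : X}

/-- The largest distance of `x` to a geodesic line with both endpoints in `S`. If these distances
are unbounded, this is the junk value `0`. -/
noncomputable def sideDist (S : Set (Boundary X)) (x : X) : ℝ :=
  ⨆ γ : {γ : GeodesicLine X // γ.negEnd ∈ S ∧ γ.posEnd ∈ S}, Metric.infDist x (range γ.1)

/-- The ideal polygons with vertex set `S` have finitely many vertices, and any two vertices are
joined by a `B`-contracting side. -/
structure HasContractingSides (B : ℝ) (S : Set (Boundary X)) : Prop where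
  finite : S.Finite
  exists_line : ∀ a ∈ S, ∀ b ∈ S, a ≠ b →
    ∃ γ : GeodesicLine X, IsContracting B γ ∧ γ.negEnd = a ∧ γ.posEnd = b

theorem HasContractingSides.mono (hS : HasContractingSides B S) (h : S' ⊆ S) :
    HasContractingSides B S' where
  finite := hS.finite.subset h
  exists_line a ha b hb := hS.exists_line a (h ha) b (h hb)

theorem sideDist_nonneg (S : Set (Boundary X)) (x : X) : 0 ≤ sideDist S x :=
  Real.iSup_nonneg fun _ => Metric.infDist_nonneg

theorem sideDist_le (hR : 0 ≤ R) (h : ∀ γ : GeodesicLine X, γ.negEnd ∈ S → γ.posEnd ∈ S →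
    Metric.infDist x (range γ) ≤ R) : sideDist S x ≤ R :=
  Real.iSup_le (fun γ => h γ.1 γ.2.1 γ.2.2) hR

theorem sideDist_smul (g : X ≃ᵢ X) (S : Set (Boundary X)) (x : X) :
    sideDist ((g • ·) '' S) (g x) = sideDist S x := by
  refine (Function.Surjective.iSup_congr (fun γ : {γ : GeodesicLine X //
    γ.negEnd ∈ S ∧ γ.posEnd ∈ S} => (⟨γ.1.map g, mem_image_of_mem _ γ.2.1,
      mem_image_of_mem _ γ.2.2⟩ : {γ : GeodesicLine X // γ.negEnd ∈ (g • ·) '' S ∧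
        γ.posEnd ∈ (g • ·) '' S})) ?_ fun γ => γ.1.infDist_map g x).symm
  rintro ⟨γ, ⟨a, ha, haγ⟩, b, hb, hbγ⟩
  refine ⟨⟨γ.map g⁻¹, ?_, ?_⟩, Subtype.ext ?_⟩
  · rwa [γ.negEnd_map, ← haγ, inv_smul_smul]
  · rwa [γ.posEnd_map, ← hbγ, inv_smul_smul]
  · exact γ.map_map_inv g

theorem HasContractingSides.bddAbove (hS : HasContractingSides B S) (hX : IsCAT0 X) (hB : 0 < B)
    (x : X) : BddAbove (range fun γ : {γ : GeodesicLine X // γ.negEnd ∈ S ∧ γ.posEnd ∈ S} =>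
      Metric.infDist x (range γ.1)) := by
  have hpairs : BddAbove (⋃ p ∈ S ×ˢ S, {d | ∃ γ : GeodesicLine X, γ.negEnd = p.1 ∧
      γ.posEnd = p.2 ∧ Metric.infDist x (range γ) = d}) := by
    refine (hS.finite.prod hS.finite).bddAbove_biUnion.2 fun p hp => ?_
    rcases eq_or_ne p.1 p.2 with heq | hne
    · refine ⟨0, ?_⟩
      rintro _ ⟨γ, hneg, hpos, -⟩
      exact absurd (hneg.trans (heq.trans hpos.symm)) γ.negEnd_ne_posEnd
    · obtain ⟨γ, hγ, hneg, hpos⟩ := hS.exists_line _ hp.1 _ hp.2 hne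
      refine ⟨Metric.infDist x (range γ) + 3 * B, ?_⟩
      rintro _ ⟨γ', hneg', hpos', rfl⟩
      exact hγ.infDist_le_add_of_parallel hX hB (hneg'.trans hneg.symm) (hpos'.trans hpos.symm) x
  refine hpairs.mono ?_
  rintro _ ⟨⟨γ, hneg, hpos⟩, rfl⟩
  exact mem_iUnion₂.2 ⟨(γ.negEnd, γ.posEnd), ⟨hneg, hpos⟩, γ, rfl, rfl, rfl⟩

theorem HasContractingSides.infDist_le_sideDist (hS : HasContractingSides B S) (hX : IsCAT0 X)
    (hB : 0 < B) {γ : GeodesicLine X} (hneg : γ.negEnd ∈ S) (hpos : γ.posEnd ∈ S) (x : X) :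
    Metric.infDist x (range γ) ≤ sideDist S x :=
  le_ciSup (hS.bddAbove hX hB x) ⟨γ, hneg, hpos⟩

theorem HasContractingSides.sideDist_mono (hS : HasContractingSides B S) (hX : IsCAT0 X)
    (hB : 0 < B) (h : S' ⊆ S) (x : X) : sideDist S' x ≤ sideDist S x :=
  sideDist_le (sideDist_nonneg S x) fun _ hneg hpos =>
    hS.infDist_le_sideDist hX hB (h hneg) (h hpos) x

theorem HasContractingSides.geodesicallyConvex_sideDist (hS : HasContractingSides B S)
    (hX : IsCAT0 X) (hB : 0 < B) : GeodesicallyConvex (sideDist S) := by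
  intro x y t z hz
  have h0 := hz.mem_Icc.1
  have h1 := sub_nonneg.2 hz.mem_Icc.2
  have := sideDist_nonneg S x
  have := sideDist_nonneg S y
  refine sideDist_le (by positivity) fun γ hneg hpos =>
    (hX.geodesicallyConvex_infDist γ hz).trans ?_
  gcongr <;> exact hS.infDist_le_sideDist hX hB hneg hpos _

theorem HasContractingSides.continuous_sideDist (hS : HasContractingSides B S) (hX : IsCAT0 X)
    (hB : 0 < B) : Continuous (sideDist S) := by
  refine (LipschitzWith.of_le_add fun x y => ?_).continuous
  refine sideDist_le (add_nonneg (sideDist_nonneg S y) dist_nonneg) fun γ hneg hpos => ?_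
  refine (Metric.infDist_le_infDist_add_dist (y := y)).trans ?_
  gcongr
  exact hS.infDist_le_sideDist hX hB hneg hpos y

theorem IsContracting.sideDist_le_add {γ : GeodesicLine X} (hγ : IsContracting B γ)
    (hX : IsCAT0 X) (hB : 0 < B) (x : X) :
    sideDist {γ.negEnd, γ.posEnd} x ≤ Metric.infDist x (range γ) + 3 * B := by
  have := Metric.infDist_nonneg (x := x) (s := range γ)
  refine sideDist_le (by positivity) ?_
  rintro σ (hneg | hneg) (hpos | hpos)
  · exact absurd (hneg.trans hpos.symm) σ.negEnd_ne_posEnd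
  · exact hγ.infDist_le_add_of_parallel hX hB hneg hpos x
  · rw [← σ.range_reverse]
    exact hγ.infDist_le_add_of_parallel hX hB (σ.negEnd_reverse.trans hpos)
      (σ.posEnd_reverse.trans hneg) x
  · exact absurd (hneg.trans hpos.symm) σ.negEnd_ne_posEnd

end SideDist

section Triangles

variable {X : Type*} [MetricSpace X] {B R : ℝ} {a b c : Boundary X} {x : X}

theorem HasContractingSides.sideDist_triple (h : HasContractingSides B {a, b, c}) (hX : IsCAT0 X)
    (hB : 0 < B) (x : X) : sideDist {a, b, c} x =
      max (sideDist {a, b} x) (max (sideDist {b, c} x) (sideDist {c, a} x)) := by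
  have hmono {S : Set (Boundary X)} (hS : S ⊆ {a, b, c}) := h.sideDist_mono hX hB hS x
  have hle {u v : Boundary X} (huv : {u, v} ⊆ ({a, b, c} : Set (Boundary X)))
      {γ : GeodesicLine X} (hneg : γ.negEnd ∈ ({u, v} : Set (Boundary X)))
      (hpos : γ.posEnd ∈ ({u, v} : Set (Boundary X))) :
      Metric.infDist x (range γ) ≤ sideDist {u, v} x :=
    (h.mono huv).infDist_le_sideDist hX hB hneg hpos x
  have hab : {a, b} ⊆ ({a, b, c} : Set (Boundary X)) := by grind
  have hbc : {b, c} ⊆ ({a, b, c} : Set (Boundary X)) := by grind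
  have hca : {c, a} ⊆ ({a, b, c} : Set (Boundary X)) := by grind
  refine le_antisymm (sideDist_le (le_max_of_le_left (sideDist_nonneg _ x)) fun γ hneg hpos => ?_)
    (max_le (hmono hab) (max_le (hmono hbc) (hmono hca)))
  rw [le_max_iff, le_max_iff]
  have hside : (γ.negEnd ∈ ({a, b} : Set (Boundary X)) ∧ γ.posEnd ∈ ({a, b} : Set (Boundary X))) ∨
      (γ.negEnd ∈ ({b, c} : Set (Boundary X)) ∧ γ.posEnd ∈ ({b, c} : Set (Boundary X))) ∨
      γ.negEnd ∈ ({c, a} : Set (Boundary X)) ∧ γ.posEnd ∈ ({c, a} : Set (Boundary X)) := by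
    grind
  exact hside.imp (fun hγ => hle hab hγ.1 hγ.2)
    (Or.imp (fun hγ => hle hbc hγ.1 hγ.2) fun hγ => hle hca hγ.1 hγ.2)

theorem HasContractingSides.exists_sideDist_triple_le (h : HasContractingSides B {a, b, c})
    (hX : IsCAT0 X) (hB : 0 < B) (hab : a ≠ b) (hbc : b ≠ c) (hca : c ≠ a) :
    ∃ x, sideDist {a, b, c} x ≤ 15 * B := by
  obtain ⟨γ, hγ, hγa, hγb⟩ := h.exists_line a (by grind) b (by grind) hab
  obtain ⟨σ, hσ, hσc, hσb⟩ := h.exists_line c (by grind) b (by grind) hbc.symm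
  obtain ⟨ρ, hρ, hρc, hρa⟩ := h.exists_line c (by grind) a (by grind) hca
  obtain ⟨x, hxγ, hxσ, hxρ⟩ := hγ.exists_mem_range_infDist_le hX hB (hσb.trans hγb.symm)
    (hρa.trans hγa.symm) (hσc.trans hρc.symm) (by rwa [hσc, hγa]) (by rw [hσc, hγb]; exact hbc.symm)
  have hγx := hγ.sideDist_le_add hX hB x
  have hσx := hσ.sideDist_le_add hX hB x
  have hρx := hρ.sideDist_le_add hX hB x
  rw [Metric.infDist_zero_of_mem hxγ, hγa, hγb] at hγx
  rw [hσc, hσb, pair_comm] at hσx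
  rw [hρc, hρa] at hρx
  refine ⟨x, ?_⟩
  rw [h.sideDist_triple hX hB]
  exact max_le (by linarith) (max_le (by linarith) (by linarith))

theorem HasContractingSides.isBounded_sideDist_triple_le (h : HasContractingSides B {a, b, c})
    (hX : IsCAT0 X) (hB : 0 < B) (hab : a ≠ b) (hbc : b ≠ c) (hca : c ≠ a) (R : ℝ) :
    Bornology.IsBounded {x | sideDist {a, b, c} x ≤ R} := by
  obtain ⟨γ, -, hγa, hγb⟩ := h.exists_line a (by grind) b (by grind) hab
  obtain ⟨σ, -, hσc, hσa⟩ := h.exists_line c (by grind) a (by grind) hca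
  obtain ⟨ρ, -, hρb, hρc⟩ := h.exists_line b (by grind) c (by grind) hbc
  have hle {τ : GeodesicLine X} (hneg : τ.negEnd ∈ ({a, b, c} : Set (Boundary X)))
      (hpos : τ.posEnd ∈ ({a, b, c} : Set (Boundary X))) {x : X} (hx : sideDist {a, b, c} x ≤ R) :
      Metric.infDist x (range τ) ≤ R := (h.infDist_le_sideDist hX hB hneg hpos x).trans hx
  have hbdd := hX.isBounded_infDist_le (γ := γ) (σ := σ) (ρ := ρ) (by rw [hγb, hσa]; exact hab.symm)
    (by rwa [hγb, hσc]) (by rw [hγa, hρc]; exact hca.symm) (by rwa [hγa, hρb]) R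
  exact hbdd.subset fun x hx => ⟨hle (by grind) (by grind) hx, hle (by grind) (by grind) hx,
    hle (by grind) (by grind) hx⟩

end Triangles

/-! ### Centers of triples of limit points -/

section Actions

variable {H P Y Z : Type*} [Group H] [TopologicalSpace H] [TopologicalSpace P] [TopologicalSpace Y]
  [TopologicalSpace Z] [MulAction H P] [MulAction H Y]

open Pointwise in
theorem sigmaCompactSpace_of_properSMul [ProperSMul H Y] [SigmaCompactSpace Y] [Nonempty Y] :
    SigmaCompactSpace H := by
  obtain ⟨y⟩ := ‹Nonempty Y›
  refine SigmaCompactSpace_iff_exists_compact_covering.2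
    ⟨fun n => {g | (g • ({y} : Set Y) ∩ compactCovering Y n).Nonempty}, fun n =>
      ProperSMul.isCompact_setOfPred_inter_nonempty isCompact_singleton
        (isCompact_compactCovering Y n), eq_univ_of_forall fun g => ?_⟩
  obtain ⟨n, hn⟩ := exists_mem_compactCovering (g • y)
  exact mem_iUnion.2 ⟨n, g • y, smul_mem_smul_set rfl, hn⟩

/- By homogeneity `F (g • p, y) = F (p, g⁻¹ • y)`, and `g ↦ g • p` is open. -/
theorem continuous_uncurry_of_invariant [IsTopologicalGroup H] [SigmaCompactSpace H]
    [ContinuousSMul H P] [MulAction.IsPretransitive H P] [BaireSpace P] [T2Space P]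
    [ContinuousSMul H Y] {F : P → Y → Z} (hF : ∀ p, Continuous (F p))
    (hinv : ∀ (g : H) p y, F (g • p) (g • y) = F p y) : Continuous (Function.uncurry F) := by
  rcases isEmpty_or_nonempty P with _ | ⟨⟨p⟩⟩
  · exact continuous_of_const fun q => isEmptyElim q.1
  have hquot : IsQuotientMap fun q : H × Y => (q.1 • p, q.2) :=
    ((isOpenMap_smul_of_sigmaCompact p).prodMap IsOpenMap.id).isQuotientMap
      (by fun_prop) ((MulAction.surjective_smul H p).prodMap Function.surjective_id)
  rw [hquot.continuous_iff]
  have hcomp : Function.uncurry F ∘ (fun q : H × Y => (q.1 • p, q.2)) =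
      fun q => F p (q.1⁻¹ • q.2) := by
    funext q
    simp only [Function.comp_apply, Function.uncurry_apply_pair, ← hinv q.1 p, smul_inv_smul]
  rw [hcomp]
  exact (hF p).comp (continuous_fst.inv.smul continuous_snd)

end Actions

section LimitTriples

variable {X : Type*} [MetricSpace X] {G : Subgroup (X ≃ᵢ X)}

/-- Ordered pairs of distinct points of the limit set. -/
def limitPairs (G : Subgroup (X ≃ᵢ X)) : SubMulAction G (limitSet G × limitSet G) where
  carrier := {p | p.1 ≠ p.2}
  smul_mem' g _ h := fun e => h (MulAction.injective g e)

theorem IsNonElementary.isPretransitive_limitSet (hG : IsNonElementary G)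
    [MulAction.IsPretransitive G (limitPairs G)] : MulAction.IsPretransitive G (limitSet G) := by
  have : Nontrivial (limitSet G) :=
    (one_lt_encard_iff_nontrivial.1 (lt_of_lt_of_le (by norm_num) hG.1)).coe_sort
  refine ⟨fun a b => ?_⟩
  obtain ⟨c, hc⟩ := exists_ne a
  obtain ⟨d, hd⟩ := exists_ne b
  obtain ⟨g, hg⟩ := MulAction.exists_smul_eq G (⟨(a, c), hc.symm⟩ : limitPairs G) ⟨(b, d), hd.symm⟩
  exact ⟨g, congrArg (fun p : limitPairs G => p.1.1) hg⟩

theorem vertices_smul (g : G) (t : limitTriples G) :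
    vertices (g • t) = ((g : X ≃ᵢ X) • ·) '' vertices t := by
  simp only [vertices, image_insert_eq, image_singleton]
  rfl

theorem finite_vertices (t : limitTriples G) : (vertices t).Finite :=
  toFinite {_, _, _}

theorem vertices_subset_limitSet (t : limitTriples G) :
    vertices t ⊆ (limitSet G : Set (Boundary X)) := by
  rintro _ (rfl | rfl | rfl)
  exacts [t.1.1.2, t.1.2.1.2, t.1.2.2.2]

theorem HasContractingSides.quasiCenters_eq {B R : ℝ} {t : limitTriples G}
    (h : HasContractingSides B (vertices t)) (hX : IsCAT0 X) (hB : 0 < B) (hR : 0 ≤ R) :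
    quasiCenters R t = {x | sideDist (vertices t) x ≤ R} :=
  Subset.antisymm (fun _ hx => sideDist_le hR hx) fun x hx _ hneg hpos =>
    (h.infDist_le_sideDist hX hB hneg hpos x).trans hx

theorem IsCAT0.metrizableSpace_limitSet [ProperSpace X] (hX : IsCAT0 X) :
    TopologicalSpace.MetrizableSpace (limitSet G) := by
  have := hX.metrizableSpace_boundary
  exact IsEmbedding.subtypeVal.metrizableSpace

theorem IsCAT0.secondCountableTopology_limitSet [ProperSpace X] (hX : IsCAT0 X) :
    SecondCountableTopology (limitSet G) := by
  have := hX.compactSpace_boundary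
  have := hX.metrizableSpace_boundary
  let _ := TopologicalSpace.metrizableSpaceMetric (Boundary X)
  exact TopologicalSpace.Subtype.secondCountableTopology _

theorem IsCAT0.compactSpace_limitSet [ProperSpace X] [MulAction.IsPretransitive G (limitSet G)]
    (hX : IsCAT0 X) : CompactSpace (limitSet G) := by
  have := hX.compactSpace_boundary
  exact isCompact_iff_compactSpace.1 isClosed_limitSet.isCompact

theorem IsCAT0.continuousSMul_limitSet [ProperSpace X] (hX : IsCAT0 X) :
    ContinuousSMul G (limitSet G) := by
  have := hX.continuousSMul_boundary
  infer_instance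

theorem exists_forall_hasContractingSides [ProperSpace X] (hX : IsCAT0 X)
    (hrank : ∃ g ∈ G, IsRankOne g) [MulAction.IsPretransitive G (limitPairs G)] :
    ∃ B > 0, ∀ S : Set (Boundary X), S.Finite → S ⊆ limitSet G → HasContractingSides B S := by
  obtain ⟨g, hg, B, hB, τ, ⟨hτ, -⟩, γ, htrans, hγ⟩ := hrank
  refine ⟨B, hB, fun S hfin hS => ⟨hfin, fun a ha b hb hab => ?_⟩⟩
  let p : limitPairs G := ⟨(⟨γ.negEnd, hX.negEnd_mem_limitSet hg hτ htrans⟩,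
    ⟨γ.posEnd, hX.posEnd_mem_limitSet hg hτ htrans⟩), fun e =>
      γ.negEnd_ne_posEnd (congrArg Subtype.val e)⟩
  let q : limitPairs G := ⟨(⟨a, hS ha⟩, ⟨b, hS hb⟩), fun e => hab (congrArg Subtype.val e)⟩
  obtain ⟨k, hk⟩ := MulAction.exists_smul_eq G p q
  exact ⟨γ.map k, hγ.map k, congrArg (fun q : limitPairs G => (q.1.1 : Boundary X)) hk,
    congrArg (fun q : limitPairs G => (q.1.2 : Boundary X)) hk⟩

theorem continuous_sideDist_limitPairs [ProperSpace X] (hX : IsCAT0 X) [ProperSMul G X]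
    [CompactSpace (limitSet G)] [MulAction.IsPretransitive G (limitPairs G)] {B : ℝ} (hB : 0 < B)
    (hsides : ∀ S : Set (Boundary X), S.Finite → S ⊆ limitSet G → HasContractingSides B S) :
    Continuous fun q : limitPairs G × X =>
      sideDist {(q.1.1.1 : Boundary X), (q.1.1.2 : Boundary X)} q.2 := by
  rcases isEmpty_or_nonempty X with _ | _
  · exact continuous_of_const fun q => isEmptyElim q.2
  have := hX.metrizableSpace_limitSet (G := G)
  have := hX.continuousSMul_limitSet (G := G)
  have : SigmaCompactSpace G := sigmaCompactSpace_of_properSMul (Y := X)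
  have hopen : IsOpen (limitPairs G : Set (limitSet G × limitSet G)) :=
    isOpen_ne_fun continuous_fst continuous_snd
  have : LocallyCompactSpace (limitPairs G) := hopen.locallyCompactSpace
  refine continuous_uncurry_of_invariant (H := G)
    (F := fun p : limitPairs G => sideDist {(p.1.1 : Boundary X), (p.1.2 : Boundary X)})
    (fun p => ?_) fun g p x => ?_
  · refine (hsides _ (toFinite _) ?_).continuous_sideDist hX hB
    rintro _ (rfl | rfl)
    exacts [p.1.1.2, p.1.2.2]
  · rw [← sideDist_smul (g : X ≃ᵢ X) _ x, image_pair]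
    rfl

theorem continuous_sideDist_vertices [ProperSpace X] (hX : IsCAT0 X) [ProperSMul G X]
    [CompactSpace (limitSet G)] [MulAction.IsPretransitive G (limitPairs G)] {B : ℝ} (hB : 0 < B)
    (hsides : ∀ S : Set (Boundary X), S.Finite → S ⊆ limitSet G → HasContractingSides B S) :
    Continuous fun q : limitTriples G × X => sideDist (vertices q.1) q.2 := by
  have hpair := continuous_sideDist_limitPairs hX hB hsides
  have hside {f g : limitTriples G → limitSet G} (hf : Continuous f) (hg : Continuous g)
      (hfg : ∀ t, f t ≠ g t) : Continuous fun q : limitTriples G × X =>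
        sideDist {(f q.1 : Boundary X), (g q.1 : Boundary X)} q.2 :=
    hpair.comp (f := fun q : limitTriples G × X =>
      ((⟨(f q.1, g q.1), hfg q.1⟩ : limitPairs G), q.2)) (by fun_prop)
  have htriple (q : limitTriples G × X) :=
    (hsides _ (finite_vertices _) (vertices_subset_limitSet q.1)).sideDist_triple hX hB q.2
  simp only [vertices, htriple]
  exact (hside (by fun_prop) (by fun_prop) fun t => t.2.1).max
    ((hside (by fun_prop) (by fun_prop) fun t => t.2.2.1).max
      (hside (by fun_prop) (by fun_prop) fun t => t.2.2.2))

theorem exists_continuous_isCenter_quasiCenters [ProperSpace X] (hX : IsCAT0 X) [ProperSMul G X]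
    [CompactSpace (limitSet G)] [MulAction.IsPretransitive G (limitPairs G)]
    (hrank : ∃ g ∈ G, IsRankOne g) :
    ∃ R > 0, ∃ Φ : limitTriples G → X, Continuous Φ ∧
      (∀ (g : G) (t : limitTriples G), Φ (g • t) = (g : X ≃ᵢ X) (Φ t)) ∧
      ∀ t : limitTriples G, (quasiCenters R t).Nonempty ∧ IsCompact (quasiCenters R t) ∧
        IsCenter (quasiCenters R t) (Φ t) := by
  obtain ⟨B, hB, hsides⟩ := exists_forall_hasContractingSides hX hrank
  have htri (t : limitTriples G) : HasContractingSides B (vertices t) :=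
    hsides _ (finite_vertices _) (vertices_subset_limitSet t)
  have hcont := continuous_sideDist_vertices hX hB hsides
  have hbdd (t : limitTriples G) : Bornology.IsBounded {x | sideDist (vertices t) x ≤ 16 * B} :=
    (htri t).isBounded_sideDist_triple_le hX hB (Subtype.coe_injective.ne t.2.1)
      (Subtype.coe_injective.ne t.2.2.1) (Subtype.coe_injective.ne t.2.2.2) _
  have hlt (t : limitTriples G) : ∃ x, sideDist (vertices t) x < 16 * B := by
    obtain ⟨x, hx⟩ := (htri t).exists_sideDist_triple_le hX hB (Subtype.coe_injective.ne t.2.1)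
      (Subtype.coe_injective.ne t.2.2.1) (Subtype.coe_injective.ne t.2.2.2)
    exact ⟨x, hx.trans_lt (by linarith)⟩
  have hnonempty (t : limitTriples G) : {x | sideDist (vertices t) x ≤ 16 * B}.Nonempty :=
    (hlt t).imp fun _ => le_of_lt
  choose Φ hΦ using fun t => exists_isCenter (hbdd t) (hnonempty t)
  refine ⟨16 * B, by positivity, Φ, ?_, fun g t => ?_, fun t => ?_⟩
  · exact continuous_isCenter_sublevel hX hcont
      (fun t => (htri t).geodesicallyConvex_sideDist hX hB) hlt hbdd hΦ
  · have himage : {x | sideDist (vertices (g • t)) x ≤ 16 * B} =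
        (g : X ≃ᵢ X) '' {x | sideDist (vertices t) x ≤ 16 * B} := by
      ext x
      obtain ⟨y, rfl⟩ := (g : X ≃ᵢ X).surjective x
      rw [(g : X ≃ᵢ X).injective.mem_set_image, vertices_smul]
      simp only [mem_ofPred_eq, sideDist_smul]
    refine hX.isCenter_unique (hbdd _) (hnonempty _) (hΦ _) ?_
    rw [himage]
    exact (hΦ t).image g
  · rw [(htri t).quasiCenters_eq hX hB (by positivity)]
    exact ⟨hnonempty t, Metric.isCompact_of_isClosed_isBounded
      (isClosed_le (hcont.comp (Continuous.prodMk_right t)) continuous_const) (hbdd t), hΦ t⟩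

end LimitTriples

/-! ### Proper and tame actions -/

section Actions

open TopologicalSpace

theorem isTameAction_of_isClosed_orbit {H S : Type*} [Group H] [TopologicalSpace S]
    [SecondCountableTopology S] [MulAction H S] [ContinuousConstSMul H S]
    (h : ∀ s : S, IsClosed (MulAction.orbit H s)) : IsTameAction H S := by
  refine ⟨fun s => (h s).isLocallyClosed, ?_⟩
  let Q := MulAction.orbitRel.Quotient H S
  have : SecondCountableTopology Q := ContinuousConstSMul.secondCountableTopology
  have hπ : IsQuotientMap (Quotient.mk (MulAction.orbitRel H S)) := isQuotientMap_quotient_mk'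
  have : T1Space Q := by
    refine ⟨fun q => ?_⟩
    obtain ⟨s, rfl⟩ := Quotient.exists_rep q
    refine hπ.isClosed_preimage.1 ?_
    convert h s using 1
    ext s'
    exact Quotient.eq
  borelize Q
  have : MeasurableSpace.CountablySeparated Q := inferInstance
  exact .mono (hsep := this) (measurable_iff_le_map.1 hπ.continuous.borel_measurable)

theorem properSMul_of_continuous_equivariant {H P Y : Type*} [Group H] [TopologicalSpace H]
    [TopologicalSpace P] [T2Space P] [MulAction H P] [ContinuousSMul H P]
    [TopologicalSpace Y] [MulAction H Y] [ProperSMul H Y] {Φ : P → Y} (hΦ : Continuous Φ)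
    (hequi : ∀ (g : H) (p : P), Φ (g • p) = g • Φ p) : ProperSMul H P := by
  refine properSMul_iff_continuousSMul_ultrafilter_tendsto_t2.2
    ⟨inferInstance, fun 𝒰 p q hpq => ?_⟩
  obtain ⟨g, -, hg⟩ := (properSMul_iff_continuousSMul_ultrafilter_tendsto.1 ‹ProperSMul H Y›).2
    (𝒰.map (Prod.map id Φ)) (Φ p) (Φ q) (by
      simpa only [Ultrafilter.coe_map, tendsto_map'_iff, Function.comp_def, Prod.map, id, hequi]
        using ((hΦ.prodMap hΦ).tendsto (p, q)).comp hpq)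
  exact ⟨g, hg⟩

theorem tendsto_measure_preimage_smul_cocompact {H P : Type*} [Group H] [TopologicalSpace H]
    [TopologicalSpace P] [T2Space P] [SigmaCompactSpace P] [MulAction H P] [ProperSMul H P]
    [MeasurableSpace P] [OpensMeasurableSpace P] (m : Measure P) [IsFiniteMeasure m] {V : Set P}
    (hV : IsCompact V) :
    Tendsto (fun g : H => m ((g • ·) ⁻¹' V)) (cocompact H) (𝓝 0) := by
  have htail : Tendsto (fun n => m (compactCovering P n)ᶜ) atTop (𝓝 0) := by
    have := tendsto_measure_iInter_atTop (μ := m) (s := fun n => (compactCovering P n)ᶜ)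
      (fun n => (isCompact_compactCovering P n).measurableSet.compl.nullMeasurableSet)
      (fun _ _ hnk => compl_subset_compl.2 (compactCovering_subset P hnk)) ⟨0, measure_ne_top _ _⟩
    rwa [← compl_iUnion, iUnion_compactCovering, compl_univ, measure_empty] at this
  refine ENNReal.tendsto_nhds_zero.2 fun ε hε => ?_
  obtain ⟨n, hn⟩ := (htail.eventually_le_const hε).exists
  filter_upwards [(ProperSMul.isCompact_setOfPred_inter_nonempty (G := H)
    (isCompact_compactCovering P n) hV).compl_mem_cocompact] with g hg
  have hsub : (g • ·) ⁻¹' V ⊆ (compactCovering P n)ᶜ := fun p hp hpn =>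
    hg ⟨g • p, mem_image_of_mem _ hpn, hp⟩
  exact (measure_mono hsub).trans hn

theorem exists_isCompact_measure_interior_ne_zero {P : Type*} [TopologicalSpace P]
    [SigmaCompactSpace P] [WeaklyLocallyCompactSpace P] [MeasurableSpace P] {m : Measure P}
    (hm : m ≠ 0) : ∃ K : Set P, IsCompact K ∧ m (interior K) ≠ 0 := by
  let K : CompactExhaustion P := default
  by_contra! hK
  refine hm (Measure.measure_univ_eq_zero.1 (measure_mono_null (fun p _ => ?_)
    (measure_iUnion_null fun n => hK (K n) (K.isCompact n))))
  obtain ⟨n, hn⟩ := K.exists_mem p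
  exact mem_iUnion.2 ⟨n + 1, K.subset_interior_succ n hn⟩

end Actions

/-! ### The action on measures -/

section Measures

open TopologicalSpace

variable {X : Type*} [MetricSpace X] {G : Subgroup (X ≃ᵢ X)}

theorem continuous_smul_probabilityMeasure [CompactSpace (limitSet G)]
    [ContinuousSMul G (limitSet G)] (μ : ProbabilityMeasure (limitSet G)) :
    Continuous fun g : G => g • μ := by
  refine ProbabilityMeasure.continuous_iff_forall_continuousMap_continuous_integral.2 fun f => ?_
  let F : C(G, C(limitSet G, ℝ)) := ContinuousMap.curry ⟨fun q => f (q.1 • q.2), by fun_prop⟩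
  have hF (g : G) : ∫ ξ, f ξ ∂(g • μ).toMeasure =
      ∫ ξ, ContinuousMap.toLp 1 μ.toMeasure ℝ (F g) ξ ∂μ := by
    rw [toMeasure_smul, integral_map (by fun_prop) (by fun_prop)]
    exact integral_congr_ae (ContinuousMap.coeFn_toLp _ (F g)).symm
  simp only [hF]
  exact continuous_integral.comp ((ContinuousMap.toLp 1 _ ℝ).continuous.comp F.continuous)

theorem isOpen_limitTriples [T2Space (limitSet G)] :
    IsOpen (limitTriples G : Set (limitSet G × limitSet G × limitSet G)) :=
  (isOpen_ne_fun (by fun_prop) (by fun_prop)).inter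
    ((isOpen_ne_fun (by fun_prop) (by fun_prop)).inter (isOpen_ne_fun (by fun_prop) (by fun_prop)))

/-- The restriction to the triples of pairwise distinct limit points of the third power of a
measure on the limit set. The action on `measuresGeThree G` is controlled by the one on triples
through it, as it is non-zero exactly for measures not concentrated on two points. -/
noncomputable def tripleMeasure (μ : ProbabilityMeasure (limitSet G)) : Measure (limitTriples G) :=
  (μ.prod (μ.prod μ)).toMeasure.comap Subtype.val

variable [T2Space (limitSet G)] [SecondCountableTopology (limitSet G)]

theorem tripleMeasure_apply (μ : ProbabilityMeasure (limitSet G)) (A : Set (limitTriples G)) :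
    tripleMeasure μ A = (μ.prod (μ.prod μ)).toMeasure (Subtype.val '' A) :=
  comap_subtype_coe_apply isOpen_limitTriples.measurableSet _ _

instance isFiniteMeasure_tripleMeasure (μ : ProbabilityMeasure (limitSet G)) :
    IsFiniteMeasure (tripleMeasure μ) :=
  ⟨by rw [tripleMeasure_apply]; exact measure_lt_top _ _⟩

theorem tripleMeasure_ne_zero {μ : ProbabilityMeasure (limitSet G)} (hμ : μ ∈ measuresGeThree G) :
    tripleMeasure μ ≠ 0 := by
  intro h
  have hae : ∀ᵐ t ∂(μ.toMeasure.prod (μ.toMeasure.prod μ)), t ∉ limitTriples G := by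
    have := tripleMeasure_apply μ univ
    rw [h, image_univ, Subtype.range_coe] at this
    simpa [ae_iff] using this.symm
  have hexists (a b : limitSet G) {p : limitSet G → Prop} (hp : ∀ᵐ c ∂μ.toMeasure, p c) :
      ∃ c, c ∉ ({a, b} : Set (limitSet G)) ∧ p c := by
    by_contra! hcon
    exact hμ a b (measure_mono_null (fun c hc => hcon c hc) hp)
  obtain ⟨a₀⟩ := μ.nonempty
  obtain ⟨a, -, ha⟩ := hexists a₀ a₀ (Measure.ae_ae_of_ae_prod hae)
  obtain ⟨b, hb, hab⟩ := hexists a a (Measure.ae_ae_of_ae_prod ha)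
  obtain ⟨c, hc, habc⟩ := hexists a b hab
  simp only [mem_insert_iff, mem_singleton_iff, not_or] at hb hc
  exact habc ⟨Ne.symm hb.1, Ne.symm hc.2, hc.1⟩

theorem tripleMeasure_smul_apply (g : G) (μ : ProbabilityMeasure (limitSet G))
    {A : Set (limitTriples G)} (hA : MeasurableSet A) :
    tripleMeasure (g • μ) A = tripleMeasure μ ((g • ·) ⁻¹' A) := by
  have hg := (limitSet_continuous_smul g).measurable
  have hsmul : Measurable ((g • ·) : limitSet G × limitSet G × limitSet G → _) :=
    hg.prodMap (hg.prodMap hg)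
  have hprod : ((g • μ).prod ((g • μ).prod (g • μ))).toMeasure =
      (μ.prod (μ.prod μ)).toMeasure.map (g • ·) := by
    simp only [ProbabilityMeasure.toMeasure_prod, toMeasure_smul]
    rw [Measure.map_prod_map _ _ hg hg, Measure.map_prod_map _ _ hg (hg.prodMap hg)]
    rfl
  rw [tripleMeasure_apply, tripleMeasure_apply, hprod]
  refine (Measure.map_apply hsmul
    (isOpen_limitTriples.measurableSet.subtype_image hA)).trans ?_
  congr 1
  ext t
  constructor
  · rintro ⟨s, hs, hst⟩
    refine ⟨g⁻¹ • s, by simpa using hs, ?_⟩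
    rw [SubMulAction.val_smul, hst, inv_smul_smul]
  · rintro ⟨s, hs, rfl⟩
    exact ⟨g • s, hs, rfl⟩

theorem lowerSemicontinuous_tripleMeasure [RegularSpace (limitSet G)]
    {O : Set (limitTriples G)} (hO : IsOpen O) :
    LowerSemicontinuous fun μ : ProbabilityMeasure (limitSet G) => tripleMeasure μ O := by
  intro μ δ hδ
  simp only [tripleMeasure_apply] at hδ ⊢
  have hcont : Continuous fun ν : ProbabilityMeasure (limitSet G) => ν.prod (ν.prod ν) :=
    ProbabilityMeasure.continuous_prod.comp (continuous_id.prodMk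
      (ProbabilityMeasure.continuous_prod.comp (continuous_id.prodMk continuous_id)))
  exact eventually_lt_of_lt_liminf (hδ.trans_le
    (ProbabilityMeasure.le_liminf_measure_open_of_tendsto (hcont.tendsto μ)
      (isOpen_limitTriples.isOpenMap_subtype_val _ hO)))

theorem isProperMap_smul_measuresGeThree [CompactSpace (limitSet G)]
    [ContinuousSMul G (limitSet G)] [ProperSMul G (limitTriples G)] (μ : measuresGeThree G) :
    IsProperMap fun g : G => g • μ := by
  have : LocallyCompactSpace (limitTriples G) := isOpen_limitTriples.locallyCompactSpace
  have : SecondCountableTopology (limitTriples G) := Subtype.secondCountableTopology _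
  refine isProperMap_iff_ultrafilter_of_t2.2
    ⟨(continuous_smul_probabilityMeasure μ.1).subtype_mk _, fun 𝒰 ν hν => ?_⟩
  obtain ⟨K, hK, hνK⟩ := exists_isCompact_measure_interior_ne_zero (tripleMeasure_ne_zero ν.2)
  obtain ⟨δ, hδ, hδν⟩ := exists_between (pos_iff_ne_zero.2 hνK)
  have hlarge : ∀ᶠ g in (𝒰 : Filter G), δ < tripleMeasure μ.1 ((g • ·) ⁻¹' K) := by
    filter_upwards [((continuous_subtype_val.tendsto ν).comp hν).eventually
      (lowerSemicontinuous_tripleMeasure isOpen_interior ν.1 δ hδν)] with g hg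
    rw [← tripleMeasure_smul_apply g μ.1 hK.measurableSet]
    exact hg.trans_le (measure_mono interior_subset)
  have hsmall := (tendsto_measure_preimage_smul_cocompact (H := G) (tripleMeasure μ.1)
    hK).eventually_lt_const hδ
  obtain ⟨C, hC, hCsub⟩ := mem_cocompact.1 hsmall
  have hC𝒰 : C ∈ 𝒰 := by
    filter_upwards [hlarge] with g hg
    by_contra hgC
    exact lt_asymm hg (hCsub hgC)
  obtain ⟨g, -, hg⟩ := hC.ultrafilter_le_nhds 𝒰 (le_principal_iff.2 hC𝒰)
  exact ⟨g, hg⟩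

theorem isCompact_stabilizer_measuresGeThree [CompactSpace (limitSet G)]
    [ContinuousSMul G (limitSet G)] [ProperSMul G (limitTriples G)] (μ : measuresGeThree G) :
    IsCompact (MulAction.stabilizer G μ : Set G) :=
  (isProperMap_smul_measuresGeThree μ).isCompact_preimage isCompact_singleton

theorem isTameAction_measuresGeThree [CompactSpace (limitSet G)]
    [ContinuousSMul G (limitSet G)] [ProperSMul G (limitTriples G)] :
    IsTameAction G (measuresGeThree G) := by
  let _ := pseudoMetrizableSpacePseudoMetric (ProbabilityMeasure (limitSet G))
  have : SecondCountableTopology (measuresGeThree G) := Subtype.secondCountableTopology _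
  have : ContinuousConstSMul G (measuresGeThree G) :=
    ⟨fun g => ((ProbabilityMeasure.continuous_map (limitSet_continuous_smul g)).comp
      continuous_subtype_val).subtype_mk _⟩
  exact isTameAction_of_isClosed_orbit fun μ =>
    (isProperMap_smul_measuresGeThree μ).isClosedMap.isClosed_range

end Measures

end RankOneCAT0

theorem mainTheorem7 {X : Type*} [MetricSpace X] [ProperSpace X]
    (hX : RankOneCAT0.IsCAT0 X)
    (G : Subgroup (X ≃ᵢ X))
    (hclosed : IsClosed (G : Set (X ≃ᵢ X)))
    (hnonel : RankOneCAT0.IsNonElementary G)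
    (hrank : ∃ g ∈ G, RankOneCAT0.IsRankOne g)
    (htrans : ∀ a b c d : RankOneCAT0.limitSet G, a ≠ b → c ≠ d →
      ∃ g : G, g • a = c ∧ g • b = d) :
    RankOneCAT0.IsTameAction G (RankOneCAT0.measuresGeThree G) ∧
    (∀ μ : RankOneCAT0.measuresGeThree G, IsCompact (MulAction.stabilizer G μ : Set G)) ∧
    ProperSMul G (RankOneCAT0.limitTriples G) ∧
    ∃ R > 0, ∃ Φ : RankOneCAT0.limitTriples G → X,
      Continuous Φ ∧
      (∀ (g : G) (t : RankOneCAT0.limitTriples G), Φ (g • t) = (g : X ≃ᵢ X) (Φ t)) ∧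
      ∀ t : RankOneCAT0.limitTriples G,
        (RankOneCAT0.quasiCenters R t).Nonempty ∧
        IsCompact (RankOneCAT0.quasiCenters R t) ∧
        RankOneCAT0.IsCenter (RankOneCAT0.quasiCenters R t) (Φ t) := by
  have : IsClosed (G : Set (X ≃ᵢ X)) := hclosed
  have : MulAction.IsPretransitive G (RankOneCAT0.limitPairs G) := by
    refine ⟨fun p q => ?_⟩
    obtain ⟨g, h₁, h₂⟩ := htrans p.1.1 p.1.2 q.1.1 q.1.2 p.2 q.2
    exact ⟨g, Subtype.ext (Prod.ext h₁ h₂)⟩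
  have := hnonel.isPretransitive_limitSet
  have := hX.metrizableSpace_limitSet (G := G)
  have := hX.secondCountableTopology_limitSet (G := G)
  have := hX.compactSpace_limitSet (G := G)
  have := hX.continuousSMul_limitSet (G := G)
  obtain ⟨R, hR, Φ, hΦ, hequi, hcenter⟩ :=
    RankOneCAT0.exists_continuous_isCenter_quasiCenters hX hrank
  have hproper : ProperSMul G (RankOneCAT0.limitTriples G) :=
    RankOneCAT0.properSMul_of_continuous_equivariant hΦ hequi
  exact ⟨RankOneCAT0.isTameAction_measuresGeThree,
    RankOneCAT0.isCompact_stabilizer_measuresGeThree, hproper, R, hR, Φ, hΦ, hequi, hcenter⟩
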